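/- For $n\in\mathbb N=\{1,2,\dots\}$ let $\mathbb H_n$ be the Heisenberg group of homogeneous dimension $Q=2n+2$, with coordinates $(x,y,z)\in\mathbb R^n\times\mathbb R^n\times\mathbb R$, Lebesgue measure $dx\,dy\,dz$ (with $|E|$ denoting the measure of $E$), and left-invariant vector fields $X_j=\partial_{x_j}+2y_j\partial_z$, $Y_j=\partial_{y_j}-2x_j\partial_z$, $1\le j\le n$. The horizontal perimeter of a measurable set $E\subset\mathbb H_n$ is $$\mathrm{Per}_{\mathbb H_n}(E)=\sup\Big\{\int_E\sum_{j=1}^n\big(X_j\phi_j+Y_j\phi_{n+j}\big)\,dx\,dy\,dz:\ \phi\in C^1_c(\mathbb H_n,\mathbb R^{2n}),\ |\phi|\le1\Big\}\in[0,\infty],$$ where $|\phi|$ is the pointwise Euclidean norm. The isoperimetric constant $I(\mathbb H_n)$ is the largest constant such that $\mathrm{Per}_{\mathbb H_n}(E)\ge I(\mathbb H_n)\,|E|^{\frac{Q-1}{Q}}$ for every measurable $E\subset\mathbb H_n$ of finite measure. Set $$\mathcal C_n=\frac{2^{n-3}\,n\,\Gamma(\frac n2)^2}{\pi^{n+1}},\qquad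 \mathcal C_n'=Q^{\frac1Q}\left(\pi^n\,\frac{\Gamma(\frac{2Q-1}{2(Q-1)})}{\Gamma(\frac{2Q-1}{2(Q-1)}+\frac12)}\,\frac{\Gamma(\frac n2+\frac{Q}{4(Q-1)})}{\Gamma(\frac n2+\frac{Q}{4(Q-1)}+\frac12)}\,\frac{\Gamma(1+\frac{Q}{2(Q-1)})}{\Gamma(n+\frac{Q}{2(Q-1)})}\right)^{\frac{Q-1}{Q}}.$$ **Theorem.** For every $n\in\mathbb N$, $$I(\mathbb H_n)\ \ge\ \mathcal C_n^{-1}(\mathcal C_n')^{-1}.$$ In particular, $$I(\mathbb H_1)\ge 8\cdot3^{-\frac98}\pi^{\frac14}\qquad\text{and}\qquad I(\mathbb H_2)\ge\pi^{\frac43}6^{-\frac16}\left(\frac{\Gamma(\frac{13}5)}{\Gamma(\frac{11}{10})}\,\frac{\Gamma(\frac95)}{\Gamma(\frac{13}{10})}\right)^{\frac56},$$ where $8\cdot3^{-\frac98}\pi^{\frac14}\approx3.09468$, with an error less than $10^{-5}$. -/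

import Mathlib

open MeasureTheory
open scoped ENNReal

noncomputable section

/-- The Heisenberg group `H_n` in its coordinates `(x, y, z)`, with `x, y ∈ ℝⁿ` and `z ∈ ℝ`.
Its Haar measure is Lebesgue measure `dx dy dz`, which is `volume` on this product. -/
abbrev HeisenbergSpace (n : ℕ) : Type := (Fin n → ℝ) × (Fin n → ℝ) × ℝ

/-- The left-invariant vector field `X_j = ∂_{x_j} + 2 y_j ∂_z`, applied to `f` at `p = (x, y, z)`. -/
def heisenbergX {n : ℕ} (j : Fin n) (f : HeisenbergSpace n → ℝ) (p : HeisenbergSpace n) : ℝ :=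
  fderiv ℝ f p (Pi.single j 1, 0, 2 * p.2.1 j)

/-- The left-invariant vector field `Y_j = ∂_{y_j} - 2 x_j ∂_z`, applied to `f` at `p = (x, y, z)`. -/
def heisenbergY {n : ℕ} (j : Fin n) (f : HeisenbergSpace n → ℝ) (p : HeisenbergSpace n) : ℝ :=
  fderiv ℝ f p (0, Pi.single j 1, -2 * p.1 j)

/-- The horizontal divergence `∑_j (X_j φ_j + Y_j φ_{n+j})` of a field `φ` with values in `ℝ²ⁿ`.
The first `n` components are indexed by `Sum.inl j`, the last `n` by `Sum.inr j`. -/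
def horizontalDiv {n : ℕ} (φ : HeisenbergSpace n → EuclideanSpace ℝ (Fin n ⊕ Fin n))
    (p : HeisenbergSpace n) : ℝ :=
  ∑ j : Fin n, (heisenbergX j (fun q => φ q (Sum.inl j)) p
    + heisenbergY j (fun q => φ q (Sum.inr j)) p)

/-- The test fields for the perimeter: `φ ∈ C¹_c(H_n, ℝ²ⁿ)` with `|φ| ≤ 1` pointwise, where `|·|`
is the Euclidean norm. -/
structure IsPerimeterTestField {n : ℕ}
    (φ : HeisenbergSpace n → EuclideanSpace ℝ (Fin n ⊕ Fin n)) : Prop where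
  contDiff : ContDiff ℝ 1 φ
  hasCompactSupport : HasCompactSupport φ
  norm_le_one : ∀ p, ‖φ p‖ ≤ 1

/-- The horizontal perimeter `sup_φ ∫_E (∑_j (X_j φ_j + Y_j φ_{n+j})) dx dy dz`, with values in
`[0, ∞]`. As `φ = 0` is a test field, the supremum is nonnegative, so that `ENNReal.ofReal`
does not change it. -/
def horizontalPerimeter {n : ℕ} (E : Set (HeisenbergSpace n)) : ℝ≥0∞ :=
  ⨆ (φ : HeisenbergSpace n → EuclideanSpace ℝ (Fin n ⊕ Fin n)) (_ : IsPerimeterTestField φ),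
    ENNReal.ofReal (∫ p in E, horizontalDiv φ p)

/-- The homogeneous dimension `Q = 2n + 2` of `H_n`. -/
def homogeneousDim (n : ℕ) : ℝ := 2 * n + 2

/-- `c` is an isoperimetric bound on `H_n` if `Per(E) ≥ c |E|^((Q-1)/Q)` for every
Lebesgue-measurable set `E` of finite measure. -/
def IsIsoperimetricBound (n : ℕ) (c : ℝ≥0∞) : Prop :=
  ∀ E : Set (HeisenbergSpace n), NullMeasurableSet E volume → volume E < ∞ →
    c * volume E ^ ((homogeneousDim n - 1) / homogeneousDim n) ≤ horizontalPerimeter E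

/-- The isoperimetric constant `I(H_n)`: the largest isoperimetric bound on `H_n`
(see `isGreatest_isoperimetricConstant`). -/
def isoperimetricConstant (n : ℕ) : ℝ≥0∞ := sSup {c | IsIsoperimetricBound n c}

theorem isGreatest_isoperimetricConstant (n : ℕ) :
    IsGreatest {c | IsIsoperimetricBound n c} (isoperimetricConstant n) := by
  refine ⟨fun E hE hfin => ?_, fun c hc => le_sSup hc⟩
  rw [isoperimetricConstant, ENNReal.sSup_mul]
  exact iSup₂_le fun c hc => hc E hE hfin

/-- `C_n = 2^(n-3) n Γ(n/2)² / π^(n+1)`. -/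
def isoConstC (n : ℕ) : ℝ :=
  2 ^ ((n : ℝ) - 3) * n * Real.Gamma (n / 2) ^ 2 / Real.pi ^ (n + 1)

/-- The constant `C_n'`, which is, with `Q = 2n + 2`,
`Q^(1/Q) (πⁿ · Γ(s)/Γ(s+1/2) · Γ(t)/Γ(t+1/2) · Γ(1+u)/Γ(n+u))^((Q-1)/Q)`, where
`s = (2Q-1)/(2(Q-1))`, `t = n/2 + Q/(4(Q-1))` and `u = Q/(2(Q-1))`. -/
def isoConstC' (n : ℕ) : ℝ :=
  let Q : ℝ := homogeneousDim n
  Q ^ (1 / Q) *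
    (Real.pi ^ n
      * (Real.Gamma ((2 * Q - 1) / (2 * (Q - 1)))
          / Real.Gamma ((2 * Q - 1) / (2 * (Q - 1)) + 1 / 2))
      * (Real.Gamma (n / 2 + Q / (4 * (Q - 1)))
          / Real.Gamma (n / 2 + Q / (4 * (Q - 1)) + 1 / 2))
      * (Real.Gamma (1 + Q / (2 * (Q - 1)))
          / Real.Gamma (n + Q / (2 * (Q - 1))))) ^ ((Q - 1) / Q)

end

/-! The proof is a duality argument: it builds a field whose horizontal divergence is close to a
multiple of the indicator of `E` and whose sup norm is controlled by `|E|` alone, and tests the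
perimeter with it.

Let `W_ε` be `kernelField ε`, that is, `-1/(2n)` times the horizontal gradient of `regularizedGauge
ε ^ (-n/2)`, a regularized fundamental solution of the sub-Laplacian. Its horizontal divergence
`kernelDensity ε` is nonnegative and is the `ε`-dilate of a fixed density of mass `C_n⁻¹`
(`horizontalDiv_kernelField`, `kernelDensity_dilation`, `lintegral_kernelDensity_one`). Take `K ⊆ E`
compact, `a > |E|`, and a continuous `0 ≤ g ≤ 1` of compact support with `g = 1` on `K` and `∫ g ≤
a`. By left invariance the field `φ(v) = ∫ g(u) W_ε(u⁻¹v) du` has nonnegative divergence, and by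
Fatou the integral of this divergence over `K` is asymptotically at least `C_n⁻¹ |K|` as `ε → 0`
(`le_of_forall_setIntegral_div_le`).

For the sup norm, let `e` be a unit vector and `k = ⟨e, W_ε⟩`. From `k ≤ t + (k - t)₊` and `0 ≤ g ≤
1` one gets `⟨e, φ⟩ ≤ t a + ∫ (k - t)₊` for every `t > 0`. A volume-preserving rotation turns `k`
into a multiple of the linear pairing with `e`; setting `ε = 0` then only enlarges the excess. The
limiting kernel is homogeneous of degree `-(Q-1)`, so its excess integral is a constant times
`t^(1-p)` with `p = Q/(Q-1)`. That constant can be computed with any suitably normalized weight, and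
a Gaussian-type weight makes it a product of Gamma values (`lintegral_limitKernel_excess`). The best
`t` yields `|φ| ≤ C_n' a^(1/Q)` (`norm_kernelConvolution_le`).

Since `φ` need not have compact support, it is multiplied by cutoffs with small horizontal gradient
(`le_horizontalPerimeter_of_div_nonneg`). Altogether `C_n⁻¹ |K| ≤ C_n' a^(1/Q) Per(E)`; letting `K`
exhaust `E` and `a` decrease to `|E|` gives the theorem. -/

noncomputable section

/-- The squared Euclidean norm `|x|² + |y|²` of the horizontal part of `(x, y, z)`. -/
def horizontalSq {n : ℕ} (p : HeisenbergSpace n) : ℝ := ∑ j, (p.1 j ^ 2 + p.2.1 j ^ 2)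

/-- The regularized fourth power `(|x|² + |y|² + ε²)² + z²` of the Korányi gauge. -/
def regularizedGauge {n : ℕ} (ε : ℝ) (p : HeisenbergSpace n) : ℝ :=
  (horizontalSq p + ε ^ 2) ^ 2 + p.2.2 ^ 2

/-- The horizontal gradient of the regularized fundamental solution, up to a constant. -/
def kernelField {n : ℕ} (ε : ℝ) (p : HeisenbergSpace n) : EuclideanSpace ℝ (Fin n ⊕ Fin n) :=
  WithLp.toLp 2 (Sum.elim
    (fun j => regularizedGauge ε p ^ (-((n : ℝ) / 2 + 1)) *
      ((horizontalSq p + ε ^ 2) * p.1 j + p.2.2 * p.2.1 j))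
    (fun j => regularizedGauge ε p ^ (-((n : ℝ) / 2 + 1)) *
      ((horizontalSq p + ε ^ 2) * p.2.1 j - p.2.2 * p.1 j)))

/-- The horizontal divergence of `kernelField ε`. -/
def kernelDensity {n : ℕ} (ε : ℝ) (p : HeisenbergSpace n) : ℝ :=
  2 * n * ε ^ 2 * regularizedGauge ε p ^ (-((n : ℝ) / 2 + 1))

/-- The product `u⁻¹ v` in the Heisenberg group. -/
def leftDiff {n : ℕ} (u v : HeisenbergSpace n) : HeisenbergSpace n :=
  (v.1 - u.1, v.2.1 - u.2.1,
    v.2.2 - u.2.2 - 2 * ∑ j, (u.2.1 j * v.1 j - u.1 j * v.2.1 j))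

/-- The homogeneous dilation `(s x, s y, s² z)`. -/
def heisenbergDilation {n : ℕ} (s : ℝ) (p : HeisenbergSpace n) : HeisenbergSpace n :=
  (s • p.1, s • p.2.1, s ^ 2 * p.2.2)

/-- The pairing of the horizontal part of a point with a vector of `ℝ²ⁿ`. -/
def horizontalPairing {n : ℕ} (e : EuclideanSpace ℝ (Fin n ⊕ Fin n)) (p : HeisenbergSpace n) : ℝ :=
  ∑ j, (p.1 j * e (Sum.inl j) + p.2.1 j * e (Sum.inr j))

end

/-! ### Divergence of the kernel field and left invariance. -/

section Calculus

variable {n : ℕ}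

lemma horizontalSq_nonneg (p : HeisenbergSpace n) : 0 ≤ horizontalSq p :=
  Finset.sum_nonneg fun _ _ => by positivity

lemma contDiff_horizontalSq {k : ℕ∞} : ContDiff ℝ k (horizontalSq (n := n)) := by
  unfold horizontalSq; fun_prop

lemma contDiff_regularizedGauge {k : ℕ∞} (ε : ℝ) :
    ContDiff ℝ k (regularizedGauge (n := n) ε) := by
  have := contDiff_horizontalSq (n := n) (k := k)
  unfold regularizedGauge; fun_prop

lemma regularizedGauge_pos {ε : ℝ} (hε : 0 < ε) (p : HeisenbergSpace n) :
    0 < regularizedGauge ε p := by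
  have := horizontalSq_nonneg p
  unfold regularizedGauge; positivity

lemma contDiff_regularizedGauge_rpow {k : ℕ∞} {ε : ℝ} (hε : 0 < ε) (r : ℝ) :
    ContDiff ℝ k (fun p : HeisenbergSpace n => regularizedGauge ε p ^ r) :=
  (contDiff_regularizedGauge ε).rpow_const_of_ne fun p => (regularizedGauge_pos hε p).ne'

lemma contDiff_kernelField {k : ℕ∞} {ε : ℝ} (hε : 0 < ε) :
    ContDiff ℝ k (kernelField (n := n) ε) := by
  have h1 := contDiff_horizontalSq (n := n) (k := k)
  have h2 := contDiff_regularizedGauge_rpow (n := n) (k := k) hε (-((n : ℝ) / 2 + 1))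
  rw [contDiff_euclidean]
  rintro (j | j) <;> simp only [kernelField, Sum.elim_inl, Sum.elim_inr] <;> fun_prop

lemma contDiff_leftDiff {k : ℕ∞} :
    ContDiff ℝ k (fun q : HeisenbergSpace n × HeisenbergSpace n => leftDiff q.1 q.2) := by
  unfold leftDiff; fun_prop

lemma continuous_kernelDensity {ε : ℝ} (hε : 0 < ε) :
    Continuous (kernelDensity (n := n) ε) :=
  continuous_const.mul (contDiff_regularizedGauge_rpow (k := 0) hε _).continuous

lemma kernelDensity_nonneg (ε : ℝ) (p : HeisenbergSpace n) : 0 ≤ kernelDensity ε p := by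
  have : 0 ≤ regularizedGauge ε p := by unfold regularizedGauge; positivity
  unfold kernelDensity; positivity

lemma fderiv_horizontalSq (p v : HeisenbergSpace n) :
    fderiv ℝ horizontalSq p v = ∑ j, (2 * p.1 j * v.1 j + 2 * p.2.1 j * v.2.1 j) := by
  have h : HasFDerivAt (horizontalSq (n := n)) (∑ j,
      ((2 * p.1 j) • (ContinuousLinearMap.proj (R := ℝ) (φ := fun _ : Fin n => ℝ) j).comp
        (ContinuousLinearMap.fst ℝ (Fin n → ℝ) ((Fin n → ℝ) × ℝ))
      + (2 * p.2.1 j) • ((ContinuousLinearMap.proj (R := ℝ) (φ := fun _ : Fin n => ℝ) j).comp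
        ((ContinuousLinearMap.fst ℝ (Fin n → ℝ) ℝ).comp
        (ContinuousLinearMap.snd ℝ (Fin n → ℝ) ((Fin n → ℝ) × ℝ)))))) p := by
    refine HasFDerivAt.fun_sum fun j _ => HasFDerivAt.add ?_ ?_
    · simpa using (((ContinuousLinearMap.proj (R := ℝ) (φ := fun _ : Fin n => ℝ) j).comp
        (ContinuousLinearMap.fst ℝ (Fin n → ℝ) ((Fin n → ℝ) × ℝ))).hasFDerivAt (x := p)).pow 2
    · simpa using (((ContinuousLinearMap.proj (R := ℝ) (φ := fun _ : Fin n => ℝ) j).comp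
        ((ContinuousLinearMap.fst ℝ (Fin n → ℝ) ℝ).comp
        (ContinuousLinearMap.snd ℝ (Fin n → ℝ) ((Fin n → ℝ) × ℝ)))).hasFDerivAt (x := p)).pow 2
  rw [h.fderiv]
  simp

lemma fderiv_x_apply (p v : HeisenbergSpace n) (j : Fin n) :
    fderiv ℝ (fun q : HeisenbergSpace n => q.1 j) p v = v.1 j :=
  congrArg (· v) ((ContinuousLinearMap.proj (R := ℝ) (φ := fun _ : Fin n => ℝ) j).comp
    (ContinuousLinearMap.fst ℝ (Fin n → ℝ) ((Fin n → ℝ) × ℝ))).fderiv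

lemma fderiv_y_apply (p v : HeisenbergSpace n) (j : Fin n) :
    fderiv ℝ (fun q : HeisenbergSpace n => q.2.1 j) p v = v.2.1 j :=
  congrArg (· v) ((ContinuousLinearMap.proj (R := ℝ) (φ := fun _ : Fin n => ℝ) j).comp
    ((ContinuousLinearMap.fst ℝ (Fin n → ℝ) ℝ).comp
      (ContinuousLinearMap.snd ℝ (Fin n → ℝ) ((Fin n → ℝ) × ℝ)))).fderiv

lemma fderiv_z_apply (p v : HeisenbergSpace n) :
    fderiv ℝ (fun q : HeisenbergSpace n => q.2.2) p v = v.2.2 :=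
  congrArg (· v) ((ContinuousLinearMap.snd ℝ (Fin n → ℝ) ℝ).comp
    (ContinuousLinearMap.snd ℝ (Fin n → ℝ) ((Fin n → ℝ) × ℝ))).fderiv

lemma differentiable_horizontalSq : Differentiable ℝ (horizontalSq (n := n)) :=
  (contDiff_horizontalSq (k := 1)).differentiable (by simp)

lemma fderiv_regularizedGauge (ε : ℝ) (p v : HeisenbergSpace n) :
    fderiv ℝ (regularizedGauge ε) p v =
      2 * (horizontalSq p + ε ^ 2) * fderiv ℝ horizontalSq p v + 2 * p.2.2 * v.2.2 := by
  have h1 : HasFDerivAt (fun q : HeisenbergSpace n => horizontalSq q + ε ^ 2)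
      (fderiv ℝ horizontalSq p) p :=
    (differentiable_horizontalSq p).hasFDerivAt.add_const _
  have h2 : HasFDerivAt (fun q : HeisenbergSpace n => q.2.2)
      (fderiv ℝ (fun q : HeisenbergSpace n => q.2.2) p) p :=
    DifferentiableAt.hasFDerivAt (by fun_prop)
  have h3 := ((h1.pow 2).add (h2.pow 2)).fderiv
  change fderiv ℝ (regularizedGauge ε) p = _ at h3
  rw [h3]
  simp only [add_apply, smul_apply, smul_eq_mul, fderiv_z_apply]
  simp
  left; ring

lemma fderiv_rpow_mul {ε : ℝ} (hε : 0 < ε) (r : ℝ) (p v : HeisenbergSpace n)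
    {a b : HeisenbergSpace n → ℝ} (ha : DifferentiableAt ℝ a p) (hb : DifferentiableAt ℝ b p) :
    fderiv ℝ (fun q => regularizedGauge ε q ^ r *
        ((horizontalSq q + ε ^ 2) * a q + q.2.2 * b q)) p v =
      regularizedGauge ε p ^ r * (fderiv ℝ horizontalSq p v * a p
        + (horizontalSq p + ε ^ 2) * fderiv ℝ a p v + v.2.2 * b p + p.2.2 * fderiv ℝ b p v)
      + r * regularizedGauge ε p ^ (r - 1) * fderiv ℝ (regularizedGauge ε) p v *
        ((horizontalSq p + ε ^ 2) * a p + p.2.2 * b p) := by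
  have h1 : HasFDerivAt (fun q : HeisenbergSpace n => horizontalSq q + ε ^ 2)
      (fderiv ℝ horizontalSq p) p :=
    (differentiable_horizontalSq p).hasFDerivAt.add_const _
  have h2 : HasFDerivAt (fun q : HeisenbergSpace n => q.2.2)
      (fderiv ℝ (fun q : HeisenbergSpace n => q.2.2) p) p :=
    DifferentiableAt.hasFDerivAt (by fun_prop)
  have h3 : HasFDerivAt (regularizedGauge ε) (fderiv ℝ (regularizedGauge ε) p) p :=
    ((contDiff_regularizedGauge (k := 1) ε).differentiable (by simp) p).hasFDerivAt
  have h4 := h3.rpow_const (p := r) (Or.inl (regularizedGauge_pos hε p).ne')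
  rw [(h4.fun_mul ((h1.fun_mul ha.hasFDerivAt).fun_add (h2.fun_mul hb.hasFDerivAt))).fderiv]
  simp [fderiv_z_apply]
  ring

/-- With `σ = horizontalSq p`, the sum over `j` produces `2n(σ + ε²) + (4 + 4r)σ`. The exponent `r =
-(n/2 + 1)` makes `4 + 4r = -2n`, so `σ` cancels and only the regularization `2nε²` survives. -/
lemma horizontalDiv_kernelField {ε : ℝ} (hε : 0 < ε) (p : HeisenbergSpace n) :
    horizontalDiv (kernelField ε) p = kernelDensity ε p := by
  have hP := regularizedGauge_pos hε p
  set r : ℝ := -((n : ℝ) / 2 + 1) with hr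
  have hpow : regularizedGauge ε p ^ (r - 1) * regularizedGauge ε p = regularizedGauge ε p ^ r := by
    rw [← Real.rpow_add_one hP.ne']; congr 1; ring
  have hsum : ∀ (f : Fin n → ℝ) (j : Fin n), ∑ i, f i * (Pi.single j (1 : ℝ) : Fin n → ℝ) i = f j := by
    intro f j
    simp [Pi.single_apply]
  have key : ∀ j : Fin n, heisenbergX j (fun q => kernelField ε q (Sum.inl j)) p
      + heisenbergY j (fun q => kernelField ε q (Sum.inr j)) p =
      regularizedGauge ε p ^ r * (2 * (horizontalSq p + ε ^ 2)
        + (4 + 4 * r) * (p.1 j ^ 2 + p.2.1 j ^ 2)) := by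
    intro j
    have e1 : (fun q : HeisenbergSpace n => kernelField ε q (Sum.inl j)) = fun q =>
        regularizedGauge ε q ^ r * ((horizontalSq q + ε ^ 2) * q.1 j + q.2.2 * q.2.1 j) := rfl
    have e2 : (fun q : HeisenbergSpace n => kernelField ε q (Sum.inr j)) = fun q =>
        regularizedGauge ε q ^ r * ((horizontalSq q + ε ^ 2) * q.2.1 j + q.2.2 * (-q.1 j)) := by
      funext q; simp [kernelField, hr]; left; ring
    have e3 : ∀ v, fderiv ℝ (fun q : HeisenbergSpace n => -q.1 j) p v = - v.1 j := by
      intro v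
      rw [fderiv_fun_neg, neg_apply, fderiv_x_apply]
    rw [e1, e2, heisenbergX, heisenbergY, fderiv_rpow_mul hε r p _ (by fun_prop) (by fun_prop),
      fderiv_rpow_mul hε r p _ (by fun_prop) (by fun_prop)]
    simp only [fderiv_regularizedGauge, fderiv_horizontalSq, fderiv_x_apply, fderiv_y_apply, e3,
      Finset.sum_add_distrib, hsum, Pi.zero_apply, mul_zero, Finset.sum_const_zero, Pi.single_eq_same,
      neg_zero]
    rw [← hpow]
    have hP' : regularizedGauge ε p = (horizontalSq p + ε ^ 2) ^ 2 + p.2.2 ^ 2 := rfl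
    generalize regularizedGauge ε p ^ (r - 1) = T at *
    rw [hP']
    ring
  rw [horizontalDiv, Finset.sum_congr rfl fun j _ => key j, ← Finset.mul_sum, Finset.sum_add_distrib,
    ← Finset.mul_sum Finset.univ _ (4 + 4 * r)]
  have : ∑ j, (p.1 j ^ 2 + p.2.1 j ^ 2) = horizontalSq p := rfl
  rw [this, kernelDensity, ← hr, Finset.sum_const, Finset.card_univ, Fintype.card_fin, nsmul_eq_mul, hr]
  ring

lemma fderiv_leftDiff (u v w : HeisenbergSpace n) :
    fderiv ℝ (leftDiff u) v w =
      (w.1, w.2.1, w.2.2 - 2 * ∑ j, (u.2.1 j * w.1 j - u.1 j * w.2.1 j)) := by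
  let L : HeisenbergSpace n →ₗ[ℝ] HeisenbergSpace n :=
    { toFun := fun w => (w.1, w.2.1, w.2.2 - 2 * ∑ j, (u.2.1 j * w.1 j - u.1 j * w.2.1 j))
      map_add' := fun a b => by
        ext <;> simp
        simp only [mul_add, Finset.sum_add_distrib]; ring
      map_smul' := fun c a => by
        ext <;> simp
        simp only [mul_sub, Finset.mul_sum]
        congr 1; congr 1 <;> exact Finset.sum_congr rfl fun _ _ => by ring }
  have h : HasFDerivAt (fun v => L.toContinuousLinearMap v - (u.1, u.2.1, u.2.2))
      L.toContinuousLinearMap v := L.toContinuousLinearMap.hasFDerivAt.sub_const _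
  have e : leftDiff u = fun v => L.toContinuousLinearMap v - (u.1, u.2.1, u.2.2) := by
    funext v; ext <;> simp [leftDiff, L]; ring
  rw [e, h.fderiv]; rfl

lemma differentiable_leftDiff (u : HeisenbergSpace n) : Differentiable ℝ (leftDiff u) := by
  unfold leftDiff; fun_prop

/-- Left invariance: the differential of `v ↦ u⁻¹v` carries the vector of `X_j` at `v` to its vector
at `u⁻¹v`. -/
lemma heisenbergX_comp_leftDiff (j : Fin n) {f : HeisenbergSpace n → ℝ} (hf : Differentiable ℝ f)
    (u v : HeisenbergSpace n) :
    heisenbergX j (fun w => f (leftDiff u w)) v = heisenbergX j f (leftDiff u v) := by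
  rw [heisenbergX, heisenbergX, fderiv_fun_comp v (hf _) (differentiable_leftDiff u v),
    ContinuousLinearMap.comp_apply, fderiv_leftDiff]
  congr 1
  ext <;> simp [leftDiff, Pi.single_apply]; ring

lemma heisenbergY_comp_leftDiff (j : Fin n) {f : HeisenbergSpace n → ℝ} (hf : Differentiable ℝ f)
    (u v : HeisenbergSpace n) :
    heisenbergY j (fun w => f (leftDiff u w)) v = heisenbergY j f (leftDiff u v) := by
  rw [heisenbergY, heisenbergY, fderiv_fun_comp v (hf _) (differentiable_leftDiff u v),
    ContinuousLinearMap.comp_apply, fderiv_leftDiff]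
  congr 1
  ext <;> simp [leftDiff, Pi.single_apply]; ring

lemma horizontalDiv_comp_leftDiff {f : HeisenbergSpace n → EuclideanSpace ℝ (Fin n ⊕ Fin n)}
    (hf : Differentiable ℝ f) (u v : HeisenbergSpace n) :
    horizontalDiv (fun w => f (leftDiff u w)) v = horizontalDiv f (leftDiff u v) := by
  have h : ∀ i, Differentiable ℝ (fun w => f w i) := fun i => by fun_prop
  exact Finset.sum_congr rfl fun j _ => congrArg₂ _ (heisenbergX_comp_leftDiff j (h _) u v)
    (heisenbergY_comp_leftDiff j (h _) u v)

end Calculus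

/-! ### Invariance of the volume: translations, dilations, rotations. -/

section Measure

variable {n : ℕ}

lemma lintegral_heisenberg {F : HeisenbergSpace n → ℝ≥0∞} (hF : Measurable F) :
    ∫⁻ p, F p = ∫⁻ x, ∫⁻ y, ∫⁻ z, F (x, y, z) := by
  rw [Measure.volume_eq_prod, lintegral_prod _ hF.aemeasurable]
  refine lintegral_congr fun x => ?_
  exact lintegral_prod (fun q => F (x, q)) (hF.comp (by fun_prop)).aemeasurable

lemma measurePreserving_of_lintegral {T : HeisenbergSpace n → HeisenbergSpace n} (hT : Measurable T)
    (h : ∀ F : HeisenbergSpace n → ℝ≥0∞, Measurable F → ∫⁻ p, F (T p) = ∫⁻ p, F p) :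
    MeasurePreserving T := by
  refine ⟨hT, Measure.ext fun s hs => ?_⟩
  have := h (s.indicator 1) (measurable_one.indicator hs)
  rw [lintegral_indicator_one hs] at this
  rw [← this, Measure.map_apply hT hs, ← lintegral_indicator_one (hT hs)]
  rfl

/-- In each variable the map is a reflection composed with a shift, and the shift in `z` depends
only on `x` and `y`; Tonelli then reduces to invariance of Lebesgue measure. -/
lemma measurePreserving_leftDiff (v : HeisenbergSpace n) :
    MeasurePreserving fun u : HeisenbergSpace n => leftDiff u v := by
  have hT : Measurable fun u : HeisenbergSpace n => leftDiff u v :=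
    ((contDiff_leftDiff (k := 0)).continuous.comp (by fun_prop : Continuous fun u => (u, v))).measurable
  refine measurePreserving_of_lintegral hT fun F hF => ?_
  have hFT : Measurable fun u => F (leftDiff u v) := hF.comp hT
  rw [lintegral_heisenberg hFT, lintegral_heisenberg hF]
  have hz : ∀ x y, ∫⁻ z, F (leftDiff (x, y, z) v) = ∫⁻ z, F (v.1 - x, v.2.1 - y, z) := by
    intro x y
    rw [← lintegral_sub_left_eq_self (fun z => F (v.1 - x, v.2.1 - y, z))
      (v.2.2 - 2 * ∑ j, (y j * v.1 j - x j * v.2.1 j))]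
    refine lintegral_congr fun z => ?_
    simp only [leftDiff]
    congr 3; ring
  simp only [hz]
  rw [← lintegral_sub_left_eq_self (fun x => ∫⁻ y, ∫⁻ z, F (x, y, z)) v.1]
  refine lintegral_congr fun x => ?_
  rw [← lintegral_sub_left_eq_self (fun y => ∫⁻ z, F (v.1 - x, y, z)) v.2.1]

lemma lintegral_comp_smul_eq {E : Type*} [NormedAddCommGroup E] [NormedSpace ℝ E]
    [MeasurableSpace E] [BorelSpace E] [FiniteDimensional ℝ E] (μ : Measure E)
    [μ.IsAddHaarMeasure] {s : ℝ} (hs : 0 < s) (f : E → ℝ≥0∞) :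
    ∫⁻ x, f (s • x) ∂μ = ENNReal.ofReal ((s ^ Module.finrank ℝ E)⁻¹) * ∫⁻ x, f x ∂μ := by
  have h := (Homeomorph.smulOfNeZero s hs.ne').measurableEmbedding.lintegral_map (μ := μ) f
  have h2 : ∫⁻ x, f (s • x) ∂μ = ∫⁻ x, f x ∂(Measure.map (s • ·) μ) := h.symm
  rw [h2, Measure.map_addHaar_smul μ hs.ne', lintegral_smul_measure, abs_of_pos (by positivity),
    smul_eq_mul]

lemma measurable_heisenbergDilation (s : ℝ) :
    Measurable (heisenbergDilation (n := n) s) := by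
  unfold heisenbergDilation; fun_prop

lemma lintegral_comp_dilation {s : ℝ} (hs : 0 < s) {F : HeisenbergSpace n → ℝ≥0∞}
    (hF : Measurable F) :
    ∫⁻ p, F (heisenbergDilation s p) = ENNReal.ofReal ((s ^ (2 * n + 2))⁻¹) * ∫⁻ p, F p := by
  have hFT : Measurable fun p => F (heisenbergDilation s p) :=
    hF.comp (measurable_heisenbergDilation s)
  rw [lintegral_heisenberg hFT, lintegral_heisenberg hF]
  have h2 : 0 < s ^ 2 := by positivity
  have hz : ∀ x y, ∫⁻ z, F (s • x, s • y, s ^ 2 * z) =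
      ENNReal.ofReal ((s ^ 2)⁻¹) * ∫⁻ z, F (s • x, s • y, z) := by
    intro x y
    simpa using lintegral_comp_smul_eq volume h2 fun z => F (s • x, s • y, z)
  have hmz : Measurable fun q : (Fin n → ℝ) × (Fin n → ℝ) => ∫⁻ z, F (q.1, q.2, z) :=
    Measurable.lintegral_prod_right' (f := fun q : ((Fin n → ℝ) × (Fin n → ℝ)) × ℝ =>
      F (q.1.1, q.1.2, q.2)) (hF.comp (by fun_prop))
  have hmy : Measurable fun x => ∫⁻ y, ∫⁻ z, F (x, y, z) :=
    Measurable.lintegral_prod_right' hmz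
  have hy : ∀ x, ∫⁻ y, ∫⁻ z, F (s • x, s • y, s ^ 2 * z) =
      ENNReal.ofReal ((s ^ 2)⁻¹) * (ENNReal.ofReal ((s ^ n)⁻¹) *
        ∫⁻ y, ∫⁻ z, F (s • x, y, z)) := by
    intro x
    simp only [hz]
    have hm : Measurable fun y => ∫⁻ z, F (s • x, y, z) :=
      hmz.comp (measurable_const.prodMk measurable_id)
    have hm' : Measurable fun y => ∫⁻ z, F (s • x, s • y, z) := hm.comp (measurable_const_smul s)
    rw [lintegral_const_mul _ hm',
      lintegral_comp_smul_eq volume hs fun y => ∫⁻ z, F (s • x, y, z)]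
    simp
  simp only [heisenbergDilation, hy]
  have hm' : Measurable fun x => ∫⁻ y, ∫⁻ z, F (s • x, y, z) := hmy.comp (measurable_const_smul s)
  rw [lintegral_const_mul _ (hm'.const_mul _), lintegral_const_mul _ hm',
    lintegral_comp_smul_eq volume hs fun x => ∫⁻ y, ∫⁻ z, F (x, y, z), ← mul_assoc, ← mul_assoc,
    ← ENNReal.ofReal_mul (by positivity), ← ENNReal.ofReal_mul (by positivity)]
  congr 2
  simp
  rw [← mul_inv, ← mul_inv]
  congr 1; ring

/-- Multiplication by `c` of the horizontal part, read as the vector `x + i y` of `ℂⁿ`. -/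
noncomputable def heisenbergRotation (c : ℂ) : HeisenbergSpace n →ₗ[ℝ] HeisenbergSpace n where
  toFun p := (c.re • p.1 - c.im • p.2.1, c.im • p.1 + c.re • p.2.1, p.2.2)
  map_add' p q := by ext <;> simp <;> ring
  map_smul' a p := by ext <;> simp <;> ring

lemma heisenbergRotation_mul (c d : ℂ) (p : HeisenbergSpace n) :
    heisenbergRotation (c * d) p = heisenbergRotation c (heisenbergRotation d p) := by
  ext <;> simp [heisenbergRotation] <;> ring

lemma heisenbergRotation_one (p : HeisenbergSpace n) : heisenbergRotation 1 p = p := by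
  ext <;> simp [heisenbergRotation]

lemma horizontalSq_rotation (c : Circle) (p : HeisenbergSpace n) :
    horizontalSq (heisenbergRotation c p) = horizontalSq p := by
  have h : (c : ℂ).re ^ 2 + (c : ℂ).im ^ 2 = 1 := by
    have := Circle.normSq_coe c
    rw [Complex.normSq_apply] at this; linarith
  refine Finset.sum_congr rfl fun j _ => ?_
  simp only [heisenbergRotation, LinearMap.coe_mk, AddHom.coe_mk, Pi.sub_apply, Pi.add_apply,
    Pi.smul_apply, smul_eq_mul]
  linear_combination (p.1 j ^ 2 + p.2.1 j ^ 2) * h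

lemma continuous_heisenbergRotation :
    Continuous fun q : Circle × HeisenbergSpace n => heisenbergRotation (n := n) q.1 q.2 := by
  simp only [heisenbergRotation, LinearMap.coe_mk, AddHom.coe_mk]
  fun_prop

instance isAddHaarMeasure_heisenberg : (volume : Measure (HeisenbergSpace n)).IsAddHaarMeasure :=
  have : (volume : Measure ((Fin n → ℝ) × ℝ)).IsAddHaarMeasure :=
    Measure.prod.instIsAddHaarMeasure (volume : Measure (Fin n → ℝ)) (volume : Measure ℝ)
  Measure.prod.instIsAddHaarMeasure (volume : Measure (Fin n → ℝ))
    (volume : Measure ((Fin n → ℝ) × ℝ))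

lemma measurePreserving_rotation (c : Circle) :
    MeasurePreserving (heisenbergRotation (n := n) (c : ℂ)) := by
  have hcont : Continuous (heisenbergRotation (n := n) (c : ℂ)) :=
    continuous_heisenbergRotation.comp (by fun_prop : Continuous fun p => (c, p))
  have hdet : LinearMap.det (heisenbergRotation (n := n) (c : ℂ)) ≠ 0 := by
    have : IsUnit (heisenbergRotation (n := n) (c : ℂ)) := by
      refine isUnit_iff_exists.2 ⟨heisenbergRotation ((c⁻¹ : Circle) : ℂ), ?_, ?_⟩ <;>
      · refine LinearMap.ext fun p => ?_
        rw [Module.End.mul_apply, ← heisenbergRotation_mul, ← Circle.coe_mul]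
        simp [heisenbergRotation_one]
    exact (this.map LinearMap.det).ne_zero
  refine ⟨hcont.measurable, ?_⟩
  have hmap := Measure.map_linearMap_addHaar_eq_smul_addHaar (volume : Measure (HeisenbergSpace n)) hdet
  set k := ENNReal.ofReal |(LinearMap.det (heisenbergRotation (n := n) (c : ℂ)))⁻¹|
  -- The determinant need not be computed: a rotation-invariant set of positive finite volume forces
  -- the scaling factor `k` to be 1.
  let S : Set (HeisenbergSpace n) := {p | horizontalSq p + p.2.2 ^ 2 < 1}
  have hS : IsOpen S := isOpen_lt
    (((contDiff_horizontalSq (k := 0)).continuous).add (by fun_prop)) continuous_const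
  have hS0 : volume S ≠ 0 := (hS.measure_pos _ ⟨0, by simp [S, horizontalSq]⟩).ne'
  have hSfin : volume S ≠ ∞ := by
    refine ((measure_mono fun p hp => ?_).trans_lt
      (measure_closedBall_lt_top (x := (0 : HeisenbergSpace n)) (r := 1))).ne
    have hp' : horizontalSq p + p.2.2 ^ 2 < 1 := hp
    have h1 : ∀ j, p.1 j ^ 2 + p.2.1 j ^ 2 ≤ horizontalSq p := fun j =>
      Finset.single_le_sum (f := fun j => p.1 j ^ 2 + p.2.1 j ^ 2) (fun _ _ => by positivity)
        (Finset.mem_univ j)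
    have h0 := horizontalSq_nonneg p
    rw [mem_closedBall_zero_iff, Prod.norm_def, Prod.norm_def]
    refine max_le ((pi_norm_le_iff_of_nonneg zero_le_one).2 fun j => ?_)
      (max_le ((pi_norm_le_iff_of_nonneg zero_le_one).2 fun j => ?_) ?_) <;>
    rw [Real.norm_eq_abs] <;> refine abs_le_one_iff_mul_self_le_one.2 ?_
    · nlinarith [h1 j, sq_nonneg (p.2.1 j), sq_nonneg p.2.2]
    · nlinarith [h1 j, sq_nonneg (p.1 j), sq_nonneg p.2.2]
    · nlinarith
  have hinv : volume S = k * volume S := by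
    have h1 := congrArg (fun μ => μ S) hmap
    simp only [Measure.smul_apply, smul_eq_mul] at h1
    rw [Measure.map_apply hcont.measurable hS.measurableSet] at h1
    rw [← h1]
    congr 1
    ext p
    simp only [S, Set.mem_preimage, Set.mem_ofPred_eq, horizontalSq_rotation]
    rfl
  have hk : k = 1 := by
    have : k * volume S = 1 * volume S := by rw [one_mul]; exact hinv.symm
    exact (ENNReal.mul_left_inj hS0 hSfin).1 this
  rw [hmap, hk, one_smul]

/-- A rotation by an angle that is itself invariant under rotations preserves the volume. -/
lemma lintegral_comp_rotation {a : HeisenbergSpace n → Circle} (ha : Continuous a)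
    (hinv : ∀ (c : Circle) p, a (heisenbergRotation c p) = a p)
    {F : HeisenbergSpace n → ℝ≥0∞} (hF : Measurable F) :
    ∫⁻ p, F (heisenbergRotation (a p) p) = ∫⁻ p, F p := by
  let _ : MeasurableSpace Circle := borel Circle
  have : BorelSpace Circle := ⟨rfl⟩
  have : SecondCountableTopology Circle :=
    inferInstanceAs (SecondCountableTopology (Metric.sphere (0 : ℂ) 1))
  let μ : Measure Circle := Measure.haar
  have hμ0 : μ Set.univ ≠ 0 := (isOpen_univ.measure_pos μ ⟨1, trivial⟩).ne'
  have hμ1 : μ Set.univ ≠ ∞ := measure_ne_top μ _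
  have hrot : Continuous fun q : HeisenbergSpace n × Circle => heisenbergRotation (q.2 : ℂ) q.1 :=
    continuous_heisenbergRotation.comp continuous_swap
  have hmul : Continuous fun q : HeisenbergSpace n × Circle =>
      heisenbergRotation ((a q.1 * q.2 : Circle) : ℂ) q.1 :=
    continuous_heisenbergRotation.comp
      (by fun_prop : Continuous fun q : HeisenbergSpace n × Circle => (a q.1 * q.2, q.1))
  have hG : Measurable fun p => F (heisenbergRotation (a p) p) :=
    hF.comp (continuous_heisenbergRotation.comp
      (by fun_prop : Continuous fun p : HeisenbergSpace n => (a p, p))).measurable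
  -- Average over all constant rotations `c`. Invariance of `a` turns the two successive rotations
  -- into one by `a p * c`, and invariance of Haar measure on the circle absorbs `a p`.
  refine (ENNReal.mul_right_inj hμ0 hμ1).1 ?_
  calc μ Set.univ * ∫⁻ p, F (heisenbergRotation (a p) p)
      = ∫⁻ c, ∫⁻ p, F (heisenbergRotation ((a p * c : Circle) : ℂ) p) ∂volume ∂μ := by
        rw [mul_comm, ← lintegral_const]
        refine lintegral_congr fun c => ?_
        rw [← (measurePreserving_rotation c).lintegral_comp hG]
        refine lintegral_congr fun p => ?_
        rw [hinv, ← heisenbergRotation_mul, Circle.coe_mul]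
    _ = ∫⁻ p, ∫⁻ c, F (heisenbergRotation ((a p * c : Circle) : ℂ) p) ∂μ ∂volume :=
        (lintegral_lintegral_swap (μ := volume) (ν := μ)
          (f := fun p c => F (heisenbergRotation ((a p * c : Circle) : ℂ) p))
          (hF.comp hmul.measurable).aemeasurable).symm
    _ = ∫⁻ p, ∫⁻ c, F (heisenbergRotation (c : ℂ) p) ∂μ ∂volume :=
        lintegral_congr fun p =>
          lintegral_mul_left_eq_self (fun c : Circle => F (heisenbergRotation (c : ℂ) p)) (a p)
    _ = ∫⁻ c, ∫⁻ p, F (heisenbergRotation (c : ℂ) p) ∂volume ∂μ :=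
        lintegral_lintegral_swap (μ := volume) (ν := μ)
          (f := fun p (c : Circle) => F (heisenbergRotation (c : ℂ) p))
          (hF.comp hrot.measurable).aemeasurable
    _ = μ Set.univ * ∫⁻ p, F p := by
        rw [mul_comm, ← lintegral_const]
        exact lintegral_congr fun c => (measurePreserving_rotation c).lintegral_comp hF

end Measure

/-! ### Gaussian and Beta-type integrals. -/

section GammaIntegrals

lemma lintegral_gaussian_norm {V : Type*} [NormedAddCommGroup V] [InnerProductSpace ℝ V]
    [FiniteDimensional ℝ V] [MeasurableSpace V] [BorelSpace V] {b : ℝ} (hb : 0 < b) :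
    ∫⁻ v : V, ENNReal.ofReal (Real.exp (-b * ‖v‖ ^ 2)) =
      ENNReal.ofReal ((Real.pi / b) ^ (Module.finrank ℝ V / 2 : ℝ)) := by
  have h := GaussianFourier.integral_rexp_neg_mul_sq_norm (V := V) hb
  rw [← h, ofReal_integral_eq_lintegral_ofReal]
  · refine .of_integral_ne_zero ?_
    rw [h]; positivity
  · exact .of_forall fun _ => (Real.exp_pos _).le

lemma lintegral_rpow_mul_exp_neg_mul {a r : ℝ} (ha : 0 < a) (hr : 0 < r) :
    ∫⁻ t in Set.Ioi (0 : ℝ), ENNReal.ofReal (t ^ (a - 1) * Real.exp (-(r * t))) =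
      ENNReal.ofReal ((1 / r) ^ a * Real.Gamma a) := by
  have h := Real.integral_rpow_mul_exp_neg_mul_Ioi ha hr
  rw [← h, ofReal_integral_eq_lintegral_ofReal]
  · refine .of_integral_ne_zero ?_
    rw [h]; positivity
  · filter_upwards [ae_restrict_mem measurableSet_Ioi] with t ht
    have : (0 : ℝ) < t := ht
    positivity

/-- Multiplied by `Γ(a)`, the negative power becomes a Laplace integral in `t`; after Tonelli the
inner integral is Gaussian and the outer one is again a Gamma integral. -/
lemma lintegral_add_sq_norm_rpow {V : Type*} [NormedAddCommGroup V] [InnerProductSpace ℝ V]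
    [FiniteDimensional ℝ V] [MeasurableSpace V] [BorelSpace V] {a b : ℝ} (hb : 0 < b)
    (ha : (Module.finrank ℝ V / 2 : ℝ) < a) :
    ∫⁻ v : V, ENNReal.ofReal ((b + ‖v‖ ^ 2) ^ (-a)) =
      ENNReal.ofReal (Real.pi ^ (Module.finrank ℝ V / 2 : ℝ) *
        Real.Gamma (a - Module.finrank ℝ V / 2) / Real.Gamma a *
        b ^ (Module.finrank ℝ V / 2 - a : ℝ)) := by
  set d : ℝ := Module.finrank ℝ V / 2 with hd
  have hd0 : 0 ≤ d := by positivity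
  have ha0 : 0 < a := hd0.trans_lt ha
  have hG : 0 < Real.Gamma a := Real.Gamma_pos_of_pos ha0
  have hG' : 0 < Real.Gamma (a - d) := Real.Gamma_pos_of_pos (by linarith)
  have h1 : ∀ v : V, ENNReal.ofReal ((b + ‖v‖ ^ 2) ^ (-a)) * ENNReal.ofReal (Real.Gamma a) =
      ∫⁻ t in Set.Ioi (0 : ℝ), ENNReal.ofReal (t ^ (a - 1) * Real.exp (-((b + ‖v‖ ^ 2) * t))) := by
    intro v
    have hv : 0 < b + ‖v‖ ^ 2 := by positivity
    rw [lintegral_rpow_mul_exp_neg_mul ha0 hv, ← ENNReal.ofReal_mul (by positivity),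
      Real.rpow_neg hv.le, Real.div_rpow zero_le_one hv.le, Real.one_rpow, one_div]
  have h2 : ∀ t ∈ Set.Ioi (0 : ℝ),
      ∫⁻ v : V, ENNReal.ofReal (t ^ (a - 1) * Real.exp (-((b + ‖v‖ ^ 2) * t))) =
      ENNReal.ofReal (Real.pi ^ d) *
        ENNReal.ofReal (t ^ (a - d - 1) * Real.exp (-(b * t))) := by
    intro t ht
    have ht : 0 < t := ht
    have e : ∀ v : V, ENNReal.ofReal (t ^ (a - 1) * Real.exp (-((b + ‖v‖ ^ 2) * t))) =
        ENNReal.ofReal (t ^ (a - 1) * Real.exp (-(b * t))) *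
          ENNReal.ofReal (Real.exp (-t * ‖v‖ ^ 2)) := by
      intro v
      rw [← ENNReal.ofReal_mul (by positivity), mul_assoc, ← Real.exp_add]
      congr 3; ring
    simp only [e]
    rw [lintegral_const_mul _ (by fun_prop), lintegral_gaussian_norm ht,
      ← ENNReal.ofReal_mul (by positivity), ← ENNReal.ofReal_mul (by positivity), ← hd,
      Real.div_rpow Real.pi_pos.le ht.le,
      show a - d - 1 = (a - 1) - d by ring, Real.rpow_sub ht (a - 1) d]
    congr 1; ring
  have h3 : (∫⁻ v : V, ENNReal.ofReal ((b + ‖v‖ ^ 2) ^ (-a))) * ENNReal.ofReal (Real.Gamma a) =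
      ENNReal.ofReal (Real.pi ^ d * ((1 / b) ^ (a - d) * Real.Gamma (a - d))) := by
    rw [← lintegral_mul_const' _ _ ENNReal.ofReal_ne_top]
    simp only [h1]
    rw [lintegral_lintegral_swap (by fun_prop), setLIntegral_congr_fun measurableSet_Ioi h2,
      lintegral_const_mul _ (by fun_prop), lintegral_rpow_mul_exp_neg_mul (by linarith) hb,
      ← ENNReal.ofReal_mul (by positivity)]
  have h4 : ENNReal.ofReal (Real.Gamma a) ≠ 0 := by simpa using hG
  rw [← ENNReal.mul_left_inj h4 ENNReal.ofReal_ne_top, h3, ← ENNReal.ofReal_mul (by positivity)]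
  congr 1
  rw [Real.div_rpow zero_le_one hb.le, Real.one_rpow, show d - a = -(a - d) by ring,
    Real.rpow_neg hb.le]
  field_simp

lemma lintegral_sq_add_sq_rpow {s q : ℝ} (hs : 0 < s) (hq : 1 / 2 < q) :
    ∫⁻ z : ℝ, ENNReal.ofReal ((s ^ 2 + z ^ 2) ^ (-q)) =
      ENNReal.ofReal (√Real.pi * Real.Gamma (q - 1 / 2) / Real.Gamma q * s ^ (1 - 2 * q)) := by
  have h := lintegral_add_sq_norm_rpow (V := ℝ) (a := q) (b := s ^ 2) (by positivity) (by simpa using hq)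
  simp only [Module.finrank_self, Nat.cast_one, Real.norm_eq_abs, sq_abs] at h
  rw [h, ← Real.rpow_natCast s 2, ← Real.rpow_mul hs.le, Real.sqrt_eq_rpow]
  congr 3
  push_cast; ring

/-- In an orthonormal basis containing `e` the integrand is a product: one half-line Gamma integral,
and a factor `√π` for each other coordinate. -/
lemma lintegral_exp_neg_sq_norm_mul_inner_rpow {ι : Type*} [Fintype ι] [Nonempty ι]
    {e : EuclideanSpace ℝ ι} (he : ‖e‖ = 1) {p : ℝ} (hp : 0 < p) :
    ∫⁻ v : EuclideanSpace ℝ ι, ENNReal.ofReal (Real.exp (-‖v‖ ^ 2) * max (inner ℝ e v) 0 ^ p) =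
      ENNReal.ofReal (Real.pi ^ ((Fintype.card ι - 1 : ℝ) / 2) * (Real.Gamma ((p + 1) / 2) / 2)) := by
  classical
  obtain ⟨i₀⟩ := ‹Nonempty ι›
  obtain ⟨b, hb⟩ := Orthonormal.exists_orthonormalBasis_extension_of_card_eq (𝕜 := ℝ)
    (E := EuclideanSpace ℝ ι) (ι := ι) (by simp) (v := fun _ => e) (s := {i₀})
    ⟨fun _ => he, fun i j hij => absurd (Subsingleton.elim i j) hij⟩
  have hb0 : b i₀ = e := hb i₀ rfl
  let f : ι → ℝ → ℝ := fun i t => Real.exp (-t ^ 2) * if i = i₀ then max t 0 ^ p else 1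
  have hf0 : ∫ t, f i₀ t = Real.Gamma ((p + 1) / 2) / 2 := by
    have h1 := integral_rpow_mul_exp_neg_rpow (p := 2) (q := p) (by norm_num) (by linarith)
    rw [show Real.Gamma ((p + 1) / 2) / 2 = 1 / 2 * Real.Gamma ((p + 1) / 2) by ring, ← h1,
      ← integral_indicator measurableSet_Ioi]
    refine integral_congr_ae (.of_forall fun t => ?_)
    simp only [f, if_true, Set.indicator, Set.mem_Ioi]
    split_ifs with ht
    · rw [max_eq_left ht.le, mul_comm]; norm_cast
    · rw [max_eq_right (not_lt.1 ht), Real.zero_rpow hp.ne', mul_zero]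
  have hf1 : ∀ i, i ≠ i₀ → ∫ t, f i t = √Real.pi := by
    intro i hi
    simpa [f, hi] using integral_gaussian 1
  have hfi : ∀ i, Integrable (f i) := by
    intro i
    refine .of_integral_ne_zero ?_
    by_cases hi : i = i₀
    · rw [hi, hf0]; positivity
    · rw [hf1 i hi]; positivity
  have hprod : ∫ x : ι → ℝ, ∏ i, f i (x i) =
      Real.pi ^ ((Fintype.card ι - 1 : ℝ) / 2) * (Real.Gamma ((p + 1) / 2) / 2) := by
    rw [integral_fintype_prod_volume_eq_prod, ← Finset.mul_prod_erase _ _ (Finset.mem_univ i₀),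
      Finset.prod_congr rfl fun i hi => hf1 i (Finset.ne_of_mem_erase hi), hf0, Finset.prod_const,
      Finset.card_erase_of_mem (Finset.mem_univ _), Finset.card_univ, Real.sqrt_eq_rpow,
      ← Real.rpow_natCast, ← Real.rpow_mul Real.pi_pos.le, mul_comm,
      Nat.cast_sub (Fintype.card_pos_iff.2 ⟨i₀⟩)]
    congr 2; push_cast; ring
  have hmp : MeasurePreserving (fun v : EuclideanSpace ℝ ι => (b.repr v).ofLp) :=
    (PiLp.volume_preserving_ofLp ι).comp b.measurePreserving_repr
  have hfm : Measurable fun x : ι → ℝ => ENNReal.ofReal (∏ i, f i (x i)) := by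
    refine ENNReal.measurable_ofReal.comp (Finset.measurable_prod _ fun i _ => ?_)
    by_cases hi : i = i₀ <;> simp only [f, hi, if_true, if_false] <;> fun_prop
  have hint : Integrable fun x : ι → ℝ => ∏ i, f i (x i) := Integrable.fintype_prod hfi
  rw [← hprod, ofReal_integral_eq_lintegral_ofReal hint
    (.of_forall fun x => Finset.prod_nonneg fun i _ => by
      simp only [f]; split_ifs <;> positivity), ← hmp.lintegral_comp hfm]
  refine lintegral_congr fun v => ?_
  congr 1
  simp only [f, Finset.prod_mul_distrib, Finset.prod_ite_eq', Finset.mem_univ, if_true,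
    ← Real.exp_sum, Finset.sum_neg_distrib]
  rw [← b.repr.norm_map v, EuclideanSpace.real_norm_sq_eq, b.repr_apply_apply, hb0]

end GammaIntegrals

/-! ### Euclidean coordinates on the horizontal part. -/

section Heisenberg

variable {n : ℕ}

/-- The point of the Heisenberg group with the given horizontal and vertical parts. -/
def ofHorizontal (ξ : EuclideanSpace ℝ (Fin n ⊕ Fin n)) (z : ℝ) : HeisenbergSpace n :=
  (fun j => ξ (Sum.inl j), fun j => ξ (Sum.inr j), z)

lemma measurable_ofHorizontal :
    Measurable fun q : EuclideanSpace ℝ (Fin n ⊕ Fin n) × ℝ => ofHorizontal q.1 q.2 := by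
  unfold ofHorizontal; fun_prop

lemma horizontalSq_ofHorizontal (ξ : EuclideanSpace ℝ (Fin n ⊕ Fin n)) (z : ℝ) :
    horizontalSq (ofHorizontal ξ z) = ‖ξ‖ ^ 2 := by
  rw [EuclideanSpace.real_norm_sq_eq, Fintype.sum_sum_type, ← Finset.sum_add_distrib]; rfl

lemma horizontalPairing_ofHorizontal (e ξ : EuclideanSpace ℝ (Fin n ⊕ Fin n)) (z : ℝ) :
    horizontalPairing e (ofHorizontal ξ z) = inner ℝ e ξ := by
  rw [PiLp.inner_apply, Fintype.sum_sum_type, ← Finset.sum_add_distrib]; rfl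

lemma lintegral_heisenberg_euclidean {F : HeisenbergSpace n → ℝ≥0∞} (hF : Measurable F) :
    ∫⁻ p, F p = ∫⁻ ξ : EuclideanSpace ℝ (Fin n ⊕ Fin n), ∫⁻ z, F (ofHorizontal ξ z) := by
  have hmp := (PiLp.volume_preserving_toLp (Fin n ⊕ Fin n)).comp
    (volume_measurePreserving_sumPiEquivProdPi_symm fun _ : Fin n ⊕ Fin n => ℝ)
  have hG : Measurable fun ξ : EuclideanSpace ℝ (Fin n ⊕ Fin n) => ∫⁻ z, F (ofHorizontal ξ z) :=
    Measurable.lintegral_prod_right' (f := fun q : EuclideanSpace ℝ (Fin n ⊕ Fin n) × ℝ =>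
      F (ofHorizontal q.1 q.2)) (hF.comp measurable_ofHorizontal)
  have hG' : Measurable fun a : (Fin n → ℝ) × (Fin n → ℝ) => ∫⁻ z, F (ofHorizontal
      ((WithLp.toLp 2 ∘ (MeasurableEquiv.sumPiEquivProdPi fun _ => ℝ).symm) a) z) :=
    hG.comp hmp.measurable
  rw [lintegral_heisenberg hF, ← hmp.lintegral_comp hG, Measure.volume_eq_prod,
    lintegral_prod _ hG'.aemeasurable]
  rfl

end Heisenberg

/-! ### Excess integrals of homogeneous functions. -/

section Homogeneity

lemma lintegral_rpow_mul_excess {N : ℕ} (hN : 1 ≤ N) {t h : ℝ} (ht : 0 < t) :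
    ∫⁻ s in Set.Ioi (0 : ℝ), ENNReal.ofReal ((s ^ (N + 2))⁻¹) * ENNReal.ofReal (s ^ N * h - t) =
      ENNReal.ofReal (t ^ (1 - (N + 1) / N : ℝ) * (N / (N + 1)) * max h 0 ^ ((N + 1) / N : ℝ)) := by
  have hN0 : (0 : ℝ) < N := by exact_mod_cast hN
  rcases le_or_gt h 0 with hh | hh
  · rw [max_eq_right hh, Real.zero_rpow (by positivity), mul_zero, ENNReal.ofReal_zero,
      setLIntegral_congr_fun (g := fun _ => 0) measurableSet_Ioi, lintegral_zero]
    intro s hs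
    have hs : 0 < s := hs
    have : s ^ N * h - t ≤ 0 := by nlinarith [mul_nonneg (pow_pos hs N).le (neg_nonneg.2 hh)]
    simp only [ENNReal.ofReal_of_nonpos this, mul_zero]
  rw [max_eq_left hh.le]
  -- The threshold beyond which `s ^ N * h` exceeds `t`; past it the integrand is a difference of
  -- two integrable powers.
  set c : ℝ := (t / h) ^ (1 / N : ℝ) with hc
  have hc0 : 0 < c := by positivity
  have hcN : c ^ N = t / h := by
    rw [hc, one_div, Real.rpow_inv_natCast_pow (by positivity) (by omega)]
  have hle : ∀ s, 0 < s → (c < s ↔ 0 < s ^ N * h - t) := by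
    intro s hs
    rw [← pow_lt_pow_iff_left₀ hc0.le hs.le (by omega : N ≠ 0), hcN, div_lt_iff₀ hh, sub_pos]
  have h1 : ∫⁻ s in Set.Ioi (0 : ℝ), ENNReal.ofReal ((s ^ (N + 2))⁻¹) *
      ENNReal.ofReal (s ^ N * h - t) =
      ∫⁻ s in Set.Ioi c, ENNReal.ofReal (h * s ^ (-2 : ℝ) - t * s ^ (-(N + 2) : ℝ)) := by
    rw [← lintegral_indicator measurableSet_Ioi, ← lintegral_indicator measurableSet_Ioi]
    refine lintegral_congr fun s => ?_
    simp only [Set.indicator, Set.mem_Ioi]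
    by_cases hs : 0 < s
    · rw [if_pos hs]
      by_cases hcs : c < s
      · rw [if_pos hcs, ← ENNReal.ofReal_mul (by positivity)]
        congr 1
        rw [Real.rpow_neg hs.le, Real.rpow_neg hs.le]
        have : s ^ ((N : ℝ) + 2) = s ^ (N + 2) := by exact_mod_cast Real.rpow_natCast s (N + 2)
        rw [this, pow_add]
        norm_cast
        field_simp
      · rw [if_neg hcs, ENNReal.ofReal_of_nonpos (not_lt.1 fun h => hcs ((hle s hs).2 h)), mul_zero]
    · rw [if_neg hs, if_neg (fun h => hs (hc0.trans h))]
  have i1 := (integrableOn_Ioi_rpow_of_lt (a := -2) (by norm_num) hc0).const_mul h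
  have i2 := (integrableOn_Ioi_rpow_of_lt (a := -(N + 2 : ℝ)) (by linarith) hc0).const_mul t
  have i3 : Integrable (fun s : ℝ => h * s ^ (-2 : ℝ) - t * s ^ (-(N + 2) : ℝ))
      (volume.restrict (Set.Ioi c)) := i1.sub i2
  rw [h1, ← ofReal_integral_eq_lintegral_ofReal i3, integral_sub i1 i2,
    integral_const_mul, integral_const_mul, integral_Ioi_rpow_of_lt (by norm_num) hc0,
    integral_Ioi_rpow_of_lt (by linarith) hc0]
  · congr 1
    have e1 : c ^ (-2 + 1 : ℝ) = c ^ N * (c ^ (N + 1))⁻¹ := by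
      rw [show (-2 + 1 : ℝ) = -1 by norm_num, Real.rpow_neg_one, pow_succ]; field_simp
    have e2 : c ^ (-(N + 2 : ℝ) + 1) = (c ^ (N + 1))⁻¹ := by
      rw [show (-(N + 2 : ℝ) + 1) = -((N + 1 : ℕ) : ℝ) by push_cast; ring, Real.rpow_neg hc0.le,
        Real.rpow_natCast]
    have e3 : (c ^ (N + 1))⁻¹ = h ^ ((N + 1) / N : ℝ) / t ^ ((N + 1) / N : ℝ) := by
      rw [← Real.rpow_natCast, hc, ← Real.rpow_mul (by positivity), ← Real.rpow_neg (by positivity),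
        ← Real.div_rpow hh.le ht.le, ← inv_div t h, Real.inv_rpow (by positivity),
        ← Real.rpow_neg (by positivity)]
      congr 1; push_cast; ring
    rw [e1, e2, hcN, e3, Real.rpow_sub ht, Real.rpow_one]
    have : (N : ℝ) + 1 ≠ 0 := by positivity
    have h' : -(N + 2 : ℝ) + 1 ≠ 0 := by linarith
    field_simp
    ring
  · filter_upwards [ae_restrict_mem measurableSet_Ioi] with s hs
    have hs : c < s := hs
    have hs0 : 0 < s := hc0.trans hs
    have h3 := (hle s hs0).1 hs
    simp only [Pi.zero_apply]
    have : h * s ^ (-2 : ℝ) - t * s ^ (-(N + 2) : ℝ) = (s ^ N * h - t) * s ^ (-(N + 2) : ℝ) := by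
      rw [sub_mul, mul_right_comm, mul_comm _ h, ← Real.rpow_natCast s N, ← Real.rpow_add hs0]
      congr 3; ring
    rw [this]; positivity

variable {n : ℕ}

/-- Insert the factor `1 = ∫ G(δ_s p) ds/s`, exchange the integrals, and undo the dilation `δ_s`. By
homogeneity `t` then enters only through the one-dimensional integral `lintegral_rpow_mul_excess`.
The weight `G` plays the role of polar coordinates and can be chosen freely. -/
lemma lintegral_excess_of_homogeneous {h G : HeisenbergSpace n → ℝ} (hh : Measurable h)
    (hG : Measurable G) (hhom : ∀ s > 0, ∀ p, s ^ (2 * n + 1) * h (heisenbergDilation s p) = h p)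
    (hGint : ∀ p, 0 < h p →
      ∫⁻ s in Set.Ioi (0 : ℝ), ENNReal.ofReal (s⁻¹ * G (heisenbergDilation s p)) = 1)
    {t : ℝ} (ht : 0 < t) :
    ∫⁻ p, ENNReal.ofReal (h p - t) =
      ENNReal.ofReal (t ^ (1 - (2 * n + 2) / (2 * n + 1) : ℝ) * ((2 * n + 1) / (2 * n + 2))) *
        ∫⁻ p, ENNReal.ofReal (G p) * ENNReal.ofReal (max (h p) 0 ^ ((2 * n + 2) / (2 * n + 1) : ℝ)) := by
  have hdil : Measurable fun q : HeisenbergSpace n × ℝ => heisenbergDilation q.2 q.1 := by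
    unfold heisenbergDilation; fun_prop
  have hGd : Measurable fun q : HeisenbergSpace n × ℝ => G (heisenbergDilation q.2 q.1) :=
    hG.comp hdil
  have step1 : ∫⁻ p, ENNReal.ofReal (h p - t) = ∫⁻ p, ∫⁻ s in Set.Ioi (0 : ℝ),
      ENNReal.ofReal (s⁻¹ * G (heisenbergDilation s p)) * ENNReal.ofReal (h p - t) := by
    refine lintegral_congr fun p => ?_
    rw [lintegral_mul_const' _ _ ENNReal.ofReal_ne_top]
    rcases le_or_gt (h p) 0 with hp | hp
    · rw [ENNReal.ofReal_of_nonpos (by linarith), mul_zero]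
    · rw [hGint p hp, one_mul]
  have step2 : ∀ s ∈ Set.Ioi (0 : ℝ),
      ∫⁻ p, ENNReal.ofReal (s⁻¹ * G (heisenbergDilation s p)) * ENNReal.ofReal (h p - t) =
      ∫⁻ p, ENNReal.ofReal (G p) * (ENNReal.ofReal ((s ^ (2 * n + 1 + 2))⁻¹) *
        ENNReal.ofReal (s ^ (2 * n + 1) * h p - t)) := by
    intro s hs
    have hs : 0 < s := hs
    have e : ∀ p, ENNReal.ofReal (s⁻¹ * G (heisenbergDilation s p)) * ENNReal.ofReal (h p - t) =
        (fun w => ENNReal.ofReal (s⁻¹ * G w) * ENNReal.ofReal (s ^ (2 * n + 1) * h w - t))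
          (heisenbergDilation s p) := fun p => by simp only [hhom s hs]
    rw [lintegral_congr e, lintegral_comp_dilation hs (F := fun w =>
        ENNReal.ofReal (s⁻¹ * G w) * ENNReal.ofReal (s ^ (2 * n + 1) * h w - t)) (by fun_prop),
      ← lintegral_const_mul' _ _ ENNReal.ofReal_ne_top]
    refine lintegral_congr fun p => ?_
    rw [← mul_assoc, ← mul_assoc, ← ENNReal.ofReal_mul (by positivity)]
    congr 1
    rw [← ENNReal.ofReal_mul' (by positivity)]
    congr 1
    field_simp
    ring
  rw [step1, lintegral_lintegral_swap, setLIntegral_congr_fun measurableSet_Ioi step2,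
    lintegral_lintegral_swap, ← lintegral_const_mul' _ _ ENNReal.ofReal_ne_top]
  · refine lintegral_congr fun p => ?_
    rw [lintegral_const_mul' _ _ ENNReal.ofReal_ne_top,
      lintegral_rpow_mul_excess (by omega) ht, mul_left_comm]
    push_cast
    rw [show (2 * (n : ℝ) + 1 + 1) = 2 * n + 2 by ring, ENNReal.ofReal_mul (by positivity)]
  · refine Measurable.aemeasurable ?_
    unfold Function.uncurry
    fun_prop
  · refine Measurable.aemeasurable ?_
    exact (ENNReal.measurable_ofReal.comp (measurable_snd.inv.mul hGd)).mul
      (ENNReal.measurable_ofReal.comp ((hh.comp measurable_fst).sub_const t))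

end Homogeneity

/-! ### Mass of the density and the Gaussian weight. -/

section Constants

variable {n : ℕ}

/-- Integrating out `z` leaves `(1 + |ξ|²)^(-(n+1))` on `ℝ²ⁿ`; both integrals are of Beta type. -/
lemma lintegral_kernelDensity_one (hn : 1 ≤ n) :
    ∫⁻ p : HeisenbergSpace n, ENNReal.ofReal (kernelDensity 1 p) =
      ENNReal.ofReal (isoConstC n)⁻¹ := by
  have hn0 : (0 : ℝ) < n := by exact_mod_cast hn
  have hz : ∀ ξ : EuclideanSpace ℝ (Fin n ⊕ Fin n),
      ∫⁻ z, ENNReal.ofReal (kernelDensity 1 (ofHorizontal ξ z)) =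
      ENNReal.ofReal (2 * n * (√Real.pi * Real.Gamma (n / 2 + 1 - 1 / 2) /
        Real.Gamma (n / 2 + 1))) * ENNReal.ofReal ((1 + ‖ξ‖ ^ 2) ^ (-(n + 1 : ℝ))) := by
    intro ξ
    have e : ∀ z, ENNReal.ofReal (kernelDensity 1 (ofHorizontal ξ z)) = ENNReal.ofReal (2 * n) *
        ENNReal.ofReal (((1 + ‖ξ‖ ^ 2) ^ 2 + z ^ 2) ^ (-(n / 2 + 1 : ℝ))) := by
      intro z
      rw [← ENNReal.ofReal_mul (by positivity), kernelDensity, regularizedGauge,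
        horizontalSq_ofHorizontal, add_comm (‖ξ‖ ^ 2)]
      simp [ofHorizontal]
    rw [lintegral_congr e, lintegral_const_mul _ (by fun_prop),
      lintegral_sq_add_sq_rpow (by positivity) (by linarith),
      ← ENNReal.ofReal_mul (by positivity),
      ← ENNReal.ofReal_mul (by
        have := Real.Gamma_pos_of_pos (show (0 : ℝ) < n / 2 + 1 - 1 / 2 by linarith)
        positivity), show (1 - 2 * (n / 2 + 1) : ℝ) = -(n + 1 : ℝ) by ring]
    congr 1; ring
  rw [lintegral_heisenberg_euclidean (continuous_kernelDensity one_pos).measurable.ennreal_ofReal,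
    lintegral_congr hz, lintegral_const_mul _ (by fun_prop),
    lintegral_add_sq_norm_rpow one_pos (by simp), ← ENNReal.ofReal_mul (by
        have := Real.Gamma_pos_of_pos (show (0 : ℝ) < n / 2 + 1 - 1 / 2 by linarith)
        positivity)]
  have hd : ((Module.finrank ℝ (EuclideanSpace ℝ (Fin n ⊕ Fin n)) : ℕ) : ℝ) / 2 = n := by
    simp
  congr 1
  rw [hd, isoConstC, add_sub_cancel_left, Real.Gamma_one, Real.one_rpow,
    show (n / 2 + 1 - 1 / 2 : ℝ) = n / 2 + 1 / 2 by ring,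
    Real.Gamma_add_one (by positivity : (n : ℝ) ≠ 0), Real.Gamma_add_one (by positivity : (n / 2 : ℝ) ≠ 0),
    Real.rpow_natCast, Real.rpow_sub two_pos]
  -- Legendre duplication trades `Γ(n/2 + 1/2)` for `Γ(n)` and `Γ(n/2)`, which produces the square
  -- of `Γ(n/2)` in `isoConstC`.
  have hdup := Real.Gamma_mul_Gamma_add_half (n / 2)
  rw [show 2 * (n / 2 : ℝ) = n by ring, Real.rpow_sub two_pos, Real.rpow_one] at hdup
  have h1 := Real.Gamma_pos_of_pos hn0
  have h2 := Real.Gamma_pos_of_pos (show (0 : ℝ) < n / 2 by linarith)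
  have h3 : Real.Gamma (n / 2 + 1 / 2) =
      2 / 2 ^ (n : ℝ) * Real.Gamma n * √Real.pi / Real.Gamma (n / 2) := by
    rw [eq_div_iff h2.ne', mul_comm]
    linear_combination hdup
  have hpi := Real.sq_sqrt Real.pi_pos.le
  have h4 : √Real.pi ≠ 0 := by positivity
  rw [h3]
  have e8 : (2 : ℝ) ^ (3 : ℝ) = 8 := by norm_num
  rw [e8]
  field_simp
  rw [hpi, pow_succ]
  ring

lemma continuous_horizontalPairing (e : EuclideanSpace ℝ (Fin n ⊕ Fin n)) :
    Continuous (horizontalPairing e) := by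
  unfold horizontalPairing; fun_prop

/-- The `z`-integral contributes `(|ξ|²)^(-(n + p/2))`, exactly cancelling the power put in the
weight; a pure Gaussian times a power of the pairing remains. -/
lemma lintegral_gaussian_mul_pairing_rpow [NeZero n] {e : EuclideanSpace ℝ (Fin n ⊕ Fin n)}
    (he : ‖e‖ = 1) {p : ℝ} (hp : 0 < p) :
    ∫⁻ w : HeisenbergSpace n, ENNReal.ofReal (horizontalSq w ^ (n + p / 2) *
        Real.exp (-horizontalSq w) * max (horizontalPairing e w) 0 ^ p *
        (horizontalSq w ^ 2 + w.2.2 ^ 2) ^ (-(n / 2 + p / 4 + 1 / 2))) =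
      ENNReal.ofReal (Real.pi ^ n * Real.Gamma ((p + 1) / 2) / 2 *
        (Real.Gamma (n / 2 + p / 4) / Real.Gamma (n / 2 + p / 4 + 1 / 2))) := by
  have hG : 0 < Real.Gamma (n / 2 + p / 4) := Real.Gamma_pos_of_pos (by positivity)
  have hz : ∀ ξ : EuclideanSpace ℝ (Fin n ⊕ Fin n),
      ∫⁻ z : ℝ, ENNReal.ofReal ((‖ξ‖ ^ 2) ^ (n + p / 2) * Real.exp (-‖ξ‖ ^ 2) *
        max (inner ℝ e ξ) 0 ^ p * ((‖ξ‖ ^ 2) ^ 2 + z ^ 2) ^ (-(n / 2 + p / 4 + 1 / 2))) =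
      ENNReal.ofReal (√Real.pi * (Real.Gamma (n / 2 + p / 4) /
        Real.Gamma (n / 2 + p / 4 + 1 / 2))) *
        ENNReal.ofReal (Real.exp (-‖ξ‖ ^ 2) * max (inner ℝ e ξ) 0 ^ p) := by
    intro ξ
    rcases eq_or_ne ξ 0 with rfl | hξ
    · simp [Real.zero_rpow hp.ne']
    have hs : 0 < ‖ξ‖ ^ 2 := by positivity
    have e : ∀ z : ℝ, ENNReal.ofReal ((‖ξ‖ ^ 2) ^ (n + p / 2) * Real.exp (-‖ξ‖ ^ 2) *
        max (inner ℝ e ξ) 0 ^ p * ((‖ξ‖ ^ 2) ^ 2 + z ^ 2) ^ (-(n / 2 + p / 4 + 1 / 2))) =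
        ENNReal.ofReal ((‖ξ‖ ^ 2) ^ (n + p / 2) * Real.exp (-‖ξ‖ ^ 2) * max (inner ℝ e ξ) 0 ^ p) *
        ENNReal.ofReal (((‖ξ‖ ^ 2) ^ 2 + z ^ 2) ^ (-(n / 2 + p / 4 + 1 / 2))) :=
      fun z => ENNReal.ofReal_mul (by positivity)
    rw [lintegral_congr e, lintegral_const_mul _ (by fun_prop),
      lintegral_sq_add_sq_rpow hs (by linarith [show (0 : ℝ) < n / 2 + p / 4 by positivity]),
      ← ENNReal.ofReal_mul (by positivity), ← ENNReal.ofReal_mul (by positivity),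
      show (1 - 2 * (n / 2 + p / 4 + 1 / 2) : ℝ) = -(n + p / 2) by ring, Real.rpow_neg hs.le,
      show (n / 2 + p / 4 + 1 / 2 - 1 / 2 : ℝ) = n / 2 + p / 4 by ring]
    congr 1
    field_simp
  have hm : Measurable fun w : HeisenbergSpace n => ENNReal.ofReal (horizontalSq w ^ (n + p / 2) *
        Real.exp (-horizontalSq w) * max (horizontalPairing e w) 0 ^ p *
        (horizontalSq w ^ 2 + w.2.2 ^ 2) ^ (-(n / 2 + p / 4 + 1 / 2))) := by
    have h1 := (contDiff_horizontalSq (n := n) (k := 0)).continuous.measurable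
    have h2 := (continuous_horizontalPairing e).measurable
    fun_prop
  rw [lintegral_heisenberg_euclidean hm]
  simp only [horizontalSq_ofHorizontal, horizontalPairing_ofHorizontal]
  simp only [ofHorizontal, hz]
  rw [lintegral_const_mul _ (by fun_prop), lintegral_exp_neg_sq_norm_mul_inner_rpow he hp,
    ← ENNReal.ofReal_mul (by positivity)]
  congr 1
  have : Real.pi ^ n = √Real.pi * Real.pi ^ ((Fintype.card (Fin n ⊕ Fin n) - 1 : ℝ) / 2) := by
    rw [Real.sqrt_eq_rpow, ← Real.rpow_add Real.pi_pos, ← Real.rpow_natCast]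
    congr 1; simp; ring
  rw [this]; ring

/-- The measure `ds/s` is scale invariant, so the value does not depend on `σ`; the factor `2/Γ(a)`
is the normalization after substituting `s²σ`. -/
lemma lintegral_gaussian_dilation {σ a : ℝ} (hσ : 0 < σ) (ha : 0 < a) :
    ∫⁻ s in Set.Ioi (0 : ℝ),
      ENNReal.ofReal (s⁻¹ * (2 / Real.Gamma a * ((s ^ 2 * σ) ^ a * Real.exp (-(s ^ 2 * σ))))) = 1 := by
  have hG := Real.Gamma_pos_of_pos ha
  have h := integral_rpow_mul_exp_neg_mul_rpow (p := 2) (q := 2 * a - 1) (b := σ) two_pos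
    (by linarith) hσ
  rw [show (2 * a - 1 + 1) / 2 = a by ring, show -(2 * a - 1 + 1) / 2 = -a by ring] at h
  have hint : IntegrableOn (fun s : ℝ => s ^ (2 * a - 1) * Real.exp (-σ * s ^ (2 : ℝ))) (Set.Ioi 0) :=
    .of_integral_ne_zero (by rw [h]; positivity)
  have e : ∀ s ∈ Set.Ioi (0 : ℝ),
      ENNReal.ofReal (s⁻¹ * (2 / Real.Gamma a * ((s ^ 2 * σ) ^ a * Real.exp (-(s ^ 2 * σ))))) =
      ENNReal.ofReal (2 / Real.Gamma a * σ ^ a) *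
        ENNReal.ofReal (s ^ (2 * a - 1) * Real.exp (-σ * s ^ (2 : ℝ))) := by
    intro s hs
    have hs : 0 < s := hs
    rw [← ENNReal.ofReal_mul (by positivity)]
    congr 1
    rw [Real.mul_rpow (by positivity) hσ.le, ← Real.rpow_natCast s 2, ← Real.rpow_mul hs.le,
      Real.rpow_sub_one hs.ne']
    push_cast
    rw [show -(s ^ (2 : ℝ) * σ) = -σ * s ^ (2 : ℝ) by ring]
    ring
  rw [setLIntegral_congr_fun measurableSet_Ioi e, lintegral_const_mul' _ _ ENNReal.ofReal_ne_top,
    ← ofReal_integral_eq_lintegral_ofReal hint, h, ← ENNReal.ofReal_mul (by positivity),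
    Real.rpow_neg hσ.le]
  · rw [ENNReal.ofReal_eq_one]; field_simp
  · filter_upwards [ae_restrict_mem measurableSet_Ioi] with s hs
    have : (0 : ℝ) < s := hs
    positivity

end Constants

/-! ### The excess of the kernel and the optimal level. -/

section KernelBound

variable {n : ℕ}

/-- The constant `K` in `∫ (k - t)₊ = t^(1-p) ((Q-1)/Q) K` for a component `k` of the limiting
kernel, where `p = Q/(Q-1)`; see `lintegral_limitKernel_excess`. -/
noncomputable def kernelConstant (n : ℕ) (p : ℝ) : ℝ :=
  Real.pi ^ n * Real.Gamma ((p + 1) / 2) *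
    (Real.Gamma (n / 2 + p / 4) / Real.Gamma (n / 2 + p / 4 + 1 / 2)) / Real.Gamma (n + p / 2)

lemma kernelConstant_pos {p : ℝ} (hp : 0 < p) : 0 < kernelConstant n p := by
  unfold kernelConstant; positivity

/-- A component of the limiting kernel, rotated so as to be a multiple of the pairing. -/
noncomputable def limitKernel (e : EuclideanSpace ℝ (Fin n ⊕ Fin n)) (w : HeisenbergSpace n) : ℝ :=
  horizontalPairing e w * (horizontalSq w ^ 2 + w.2.2 ^ 2) ^ (-((n + 1 : ℝ) / 2))

lemma horizontalPairing_eq_zero (e : EuclideanSpace ℝ (Fin n ⊕ Fin n)) (w : HeisenbergSpace n)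
    (h : horizontalSq w = 0) : horizontalPairing e w = 0 := by
  have h1 := (Finset.sum_eq_zero_iff_of_nonneg fun j _ => by positivity).1 h
  refine Finset.sum_eq_zero fun j hj => ?_
  have h2 := h1 j hj
  have hx : w.1 j = 0 := by nlinarith [sq_nonneg (w.1 j), sq_nonneg (w.2.1 j)]
  have hy : w.2.1 j = 0 := by nlinarith [sq_nonneg (w.1 j), sq_nonneg (w.2.1 j)]
  rw [hx, hy]; ring

lemma horizontalSq_pos_of_pairing_pos {e : EuclideanSpace ℝ (Fin n ⊕ Fin n)}
    {w : HeisenbergSpace n} (h : 0 < horizontalPairing e w) : 0 < horizontalSq w :=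
  (horizontalSq_nonneg w).lt_of_ne fun h0 => h.ne' (horizontalPairing_eq_zero e w h0.symm)

lemma horizontalSq_dilation (s : ℝ) (w : HeisenbergSpace n) :
    horizontalSq (heisenbergDilation s w) = s ^ 2 * horizontalSq w := by
  simp only [horizontalSq, heisenbergDilation, Pi.smul_apply, smul_eq_mul, Finset.mul_sum]
  exact Finset.sum_congr rfl fun j _ => by ring

lemma horizontalPairing_dilation (e : EuclideanSpace ℝ (Fin n ⊕ Fin n)) (s : ℝ)
    (w : HeisenbergSpace n) :
    horizontalPairing e (heisenbergDilation s w) = s * horizontalPairing e w := by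
  simp only [horizontalPairing, heisenbergDilation, Pi.smul_apply, smul_eq_mul, Finset.mul_sum]
  exact Finset.sum_congr rfl fun j _ => by ring

lemma measurable_limitKernel (e : EuclideanSpace ℝ (Fin n ⊕ Fin n)) :
    Measurable (limitKernel e) := by
  have h1 := (contDiff_horizontalSq (n := n) (k := 0)).continuous.measurable
  have h2 := (continuous_horizontalPairing e).measurable
  unfold limitKernel; fun_prop

/-- The limiting kernel is homogeneous of degree `1 - 2(n + 1) = -(Q - 1)`, so
`lintegral_excess_of_homogeneous` applies. -/
lemma lintegral_limitKernel_excess [NeZero n] {e : EuclideanSpace ℝ (Fin n ⊕ Fin n)}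
    (he : ‖e‖ = 1) {t : ℝ} (ht : 0 < t) :
    ∫⁻ w, ENNReal.ofReal (limitKernel e w - t) =
      ENNReal.ofReal (t ^ (1 - (2 * n + 2) / (2 * n + 1) : ℝ) * ((2 * n + 1) / (2 * n + 2)) *
        kernelConstant n ((2 * n + 2) / (2 * n + 1))) := by
  set p : ℝ := (2 * n + 2) / (2 * n + 1) with hp
  have hp0 : 0 < p := by positivity
  have hsq := (contDiff_horizontalSq (n := n) (k := 0)).continuous.measurable
  -- Any positive exponent would allow normalization; `n + p/2` is the one that makes the
  -- `z`-integral cancel in `lintegral_gaussian_mul_pairing_rpow`.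
  let G : HeisenbergSpace n → ℝ := fun w =>
    2 / Real.Gamma (n + p / 2) * (horizontalSq w ^ (n + p / 2) * Real.exp (-horizontalSq w))
  have hG : Measurable G := by fun_prop
  have hΓ : 0 < Real.Gamma (n + p / 2) := Real.Gamma_pos_of_pos (by positivity)
  have h := lintegral_excess_of_homogeneous (measurable_limitKernel e) hG ?_ ?_ ht
  · rw [← hp] at h
    rw [h, ENNReal.ofReal_mul (p := t ^ (1 - p) * ((2 * n + 1) / (2 * n + 2))) (by positivity)]
    congr 1
    have e1 : ∀ w, ENNReal.ofReal (G w) * ENNReal.ofReal (max (limitKernel e w) 0 ^ p) =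
        ENNReal.ofReal (2 / Real.Gamma (n + p / 2)) * ENNReal.ofReal (horizontalSq w ^ (n + p / 2) *
        Real.exp (-horizontalSq w) * max (horizontalPairing e w) 0 ^ p *
        (horizontalSq w ^ 2 + w.2.2 ^ 2) ^ (-(n / 2 + p / 4 + 1 / 2))) := by
      intro w
      have hs := horizontalSq_nonneg w
      have hc : 0 ≤ horizontalSq w ^ 2 + w.2.2 ^ 2 := by positivity
      rw [← ENNReal.ofReal_mul (by positivity), ← ENNReal.ofReal_mul (by positivity)]
      congr 1
      have hmax : max (limitKernel e w) 0 = max (horizontalPairing e w) 0 *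
          (horizontalSq w ^ 2 + w.2.2 ^ 2) ^ (-((n + 1 : ℝ) / 2)) := by
        rw [max_mul_of_nonneg _ _ (by positivity), zero_mul, limitKernel]
      rw [hmax, Real.mul_rpow (le_max_right _ _) (by positivity), ← Real.rpow_mul hc,
        show -((n + 1 : ℝ) / 2) * p = -(n / 2 + p / 4 + 1 / 2) by rw [hp]; field_simp; ring]
      ring
    rw [lintegral_congr e1, lintegral_const_mul' _ _ ENNReal.ofReal_ne_top,
      lintegral_gaussian_mul_pairing_rpow he hp0, ← ENNReal.ofReal_mul (by positivity),
      kernelConstant]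
    congr 1; field_simp
  · intro s hs w
    have hs0 : 0 < s := hs
    have hc : 0 ≤ horizontalSq w ^ 2 + w.2.2 ^ 2 := by positivity
    rw [limitKernel, horizontalPairing_dilation, horizontalSq_dilation]
    have e2 : (s ^ 2 * horizontalSq w) ^ 2 + (heisenbergDilation s w).2.2 ^ 2 =
        s ^ 4 * (horizontalSq w ^ 2 + w.2.2 ^ 2) := by
      simp only [heisenbergDilation]; ring
    have e3 : (s ^ 4) ^ (-((n + 1 : ℝ) / 2)) = (s ^ (2 * n + 2))⁻¹ := by
      rw [← Real.rpow_natCast, ← Real.rpow_mul hs0.le, ← Real.rpow_natCast, ← Real.rpow_neg hs0.le]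
      congr 1; push_cast; ring
    rw [e2, Real.mul_rpow (by positivity) hc, e3, limitKernel, pow_succ s (2 * n + 1)]
    field_simp
  · intro w hw
    have hpos : 0 < horizontalPairing e w := by
      by_contra hneg
      refine absurd hw (not_lt.2 ?_)
      exact mul_nonpos_of_nonpos_of_nonneg (not_lt.1 hneg) (by positivity)
    simp only [G, horizontalSq_dilation]
    exact lintegral_gaussian_dilation (horizontalSq_pos_of_pairing_pos hpos) (by positivity)

/-- The phase `(|ζ|² + ε² - i z) / |·|` by which the kernel field is rotated. -/
noncomputable def kernelPhase (ε : ℝ) (w : HeisenbergSpace n) : ℂ :=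
  ⟨(horizontalSq w + ε ^ 2) / √(regularizedGauge ε w), -w.2.2 / √(regularizedGauge ε w)⟩

lemma continuous_kernelPhase {ε : ℝ} (hε : 0 < ε) : Continuous (kernelPhase (n := n) ε) := by
  have h1 := (contDiff_horizontalSq (n := n) (k := 0)).continuous
  have h2 := (contDiff_regularizedGauge (n := n) (k := 0) ε).continuous
  have h3 : ∀ w : HeisenbergSpace n, √(regularizedGauge ε w) ≠ 0 := fun w =>
    (Real.sqrt_pos.2 (regularizedGauge_pos hε w)).ne'
  have e : kernelPhase (n := n) ε = fun w => Complex.equivRealProdCLM.symm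
      ((horizontalSq w + ε ^ 2) / √(regularizedGauge ε w), -w.2.2 / √(regularizedGauge ε w)) := by
    funext w; apply Complex.ext <;> simp [kernelPhase]
  rw [e]
  refine Complex.equivRealProdCLM.symm.continuous.comp (.prodMk ?_ ?_)
  · exact (h1.add continuous_const).div h2.sqrt h3
  · exact (continuous_snd.comp continuous_snd).neg.div h2.sqrt h3

lemma norm_kernelPhase {ε : ℝ} (hε : 0 < ε) (w : HeisenbergSpace n) : ‖kernelPhase ε w‖ = 1 := by
  have h0 := regularizedGauge_pos hε w
  have h1 := Real.sq_sqrt h0.le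
  have h2 : √(regularizedGauge ε w) ≠ 0 := (Real.sqrt_pos.2 h0).ne'
  rw [← sq_eq_sq₀ (norm_nonneg _) zero_le_one, Complex.sq_norm, Complex.normSq_apply, kernelPhase]
  field_simp
  rw [h1, regularizedGauge]

/-- In complex notation the field is a power of the gauge times `(σ + ε² - iz)(x + iy)`, where `σ =
horizontalSq w`. The scalar has modulus `√(regularizedGauge ε w)`, which accounts for the change of
exponent by `1/2`. -/
lemma inner_kernelField {ε : ℝ} (hε : 0 < ε) (e : EuclideanSpace ℝ (Fin n ⊕ Fin n))
    (w : HeisenbergSpace n) :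
    inner ℝ e (kernelField ε w) = horizontalPairing e (heisenbergRotation (kernelPhase ε w) w) *
      regularizedGauge ε w ^ (-((n + 1 : ℝ) / 2)) := by
  have h0 := regularizedGauge_pos hε w
  have h1 : regularizedGauge ε w ^ (-((n : ℝ) / 2 + 1)) =
      regularizedGauge ε w ^ (-((n + 1 : ℝ) / 2)) / √(regularizedGauge ε w) := by
    rw [Real.sqrt_eq_rpow, ← Real.rpow_sub h0]; congr 1; ring
  rw [PiLp.inner_apply, Fintype.sum_sum_type, ← Finset.sum_add_distrib, horizontalPairing,
    Finset.sum_mul]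
  refine Finset.sum_congr rfl fun j _ => ?_
  simp only [kernelField, Sum.elim_inl, Sum.elim_inr, h1, heisenbergRotation, kernelPhase,
    LinearMap.coe_mk, AddHom.coe_mk, Pi.sub_apply, Pi.add_apply, Pi.smul_apply, smul_eq_mul,
    RCLike.inner_apply, conj_trivial]
  ring

lemma regularizedGauge_rotation (ε : ℝ) (c : Circle) (w : HeisenbergSpace n) :
    regularizedGauge ε (heisenbergRotation c w) = regularizedGauge ε w := by
  rw [regularizedGauge, horizontalSq_rotation]; rfl

/-- The phase depends only on `horizontalSq` and `z`, so rotating it away preserves the integral.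
Where the pairing is positive, lowering `ε` to 0 increases the negative power of the gauge;
elsewhere the excess over `t > 0` vanishes. -/
lemma lintegral_inner_kernelField_excess_le [NeZero n] {e : EuclideanSpace ℝ (Fin n ⊕ Fin n)}
    (he : ‖e‖ = 1) {ε t : ℝ} (hε : 0 < ε) (ht : 0 < t) :
    ∫⁻ w : HeisenbergSpace n, ENNReal.ofReal (inner ℝ e (kernelField ε w) - t) ≤
      ENNReal.ofReal (t ^ (1 - (2 * n + 2) / (2 * n + 1) : ℝ) * ((2 * n + 1) / (2 * n + 2)) *
        kernelConstant n ((2 * n + 2) / (2 * n + 1))) := by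
  let a : HeisenbergSpace n → Circle := fun w =>
    ⟨kernelPhase ε w, mem_sphere_zero_iff_norm.2 (norm_kernelPhase hε w)⟩
  have ha : Continuous a := (continuous_kernelPhase hε).subtype_mk _
  have hinv : ∀ (c : Circle) w, a (heisenbergRotation c w) = a w := by
    intro c w
    refine Circle.ext ?_
    change kernelPhase ε (heisenbergRotation c w) = kernelPhase ε w
    simp only [kernelPhase, regularizedGauge_rotation, horizontalSq_rotation]
    rfl
  let F : HeisenbergSpace n → ℝ≥0∞ := fun w => ENNReal.ofReal
    (horizontalPairing e w * regularizedGauge ε w ^ (-((n + 1 : ℝ) / 2)) - t)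
  have hF : Measurable F := by
    have h2 := (continuous_horizontalPairing e).measurable
    have h3 := (contDiff_regularizedGauge (n := n) (k := 0) ε).continuous.measurable
    fun_prop
  have e1 : ∀ w : HeisenbergSpace n, ENNReal.ofReal (inner ℝ e (kernelField ε w) - t) =
      F (heisenbergRotation (a w) w) := by
    intro w
    simp only [F, regularizedGauge_rotation]
    rw [inner_kernelField hε]
  rw [lintegral_congr e1, lintegral_comp_rotation ha hinv hF, ← lintegral_limitKernel_excess he ht]
  refine lintegral_mono fun w => ?_
  rcases le_or_gt (horizontalPairing e w) 0 with hw | hw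
  · have h1 : horizontalPairing e w * regularizedGauge ε w ^ (-((n + 1 : ℝ) / 2)) ≤ 0 :=
      mul_nonpos_of_nonpos_of_nonneg hw (Real.rpow_nonneg (regularizedGauge_pos hε w).le _)
    simp only [F]
    rw [ENNReal.ofReal_of_nonpos (by linarith)]
    exact zero_le
  · have hs := horizontalSq_pos_of_pairing_pos hw
    refine ENNReal.ofReal_le_ofReal (sub_le_sub_right (mul_le_mul_of_nonneg_left ?_ hw.le) _)
    refine Real.rpow_le_rpow_of_nonpos (by positivity) ?_ (by linarith [show (0 : ℝ) ≤ n by positivity])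
    unfold regularizedGauge
    gcongr
    nlinarith [sq_nonneg ε]

/-- With `p = Q/(Q-1)` the first Gamma quotient is `Γ((p+1)/2)/Γ(1 + p/2)`, whose denominator
cancels the numerator of the third. -/
lemma isoConstC'_eq (n : ℕ) :
    isoConstC' n = (2 * n + 2) ^ (1 / (2 * n + 2) : ℝ) *
      kernelConstant n ((2 * n + 2) / (2 * n + 1)) ^ ((2 * n + 1) / (2 * n + 2) : ℝ) := by
  have h : (2 * (n : ℝ) + 2 - 1) = 2 * n + 1 := by ring
  simp only [isoConstC', homogeneousDim, h]
  congr 2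
  set p : ℝ := (2 * n + 2) / (2 * n + 1) with hp
  have hp0 : 0 < p := by positivity
  have e1 : (2 * (2 * n + 2) - 1) / (2 * (2 * n + 1)) = (p + 1) / 2 := by
    rw [hp]; field_simp; ring
  have e2 : (2 * n + 2) / (4 * (2 * n + 1)) = p / 4 := by rw [hp]; field_simp
  have e3 : (2 * n + 2) / (2 * (2 * n + 1)) = p / 2 := by rw [hp]; field_simp
  rw [e1, e2, e3, kernelConstant, show (p + 1) / 2 + 1 / 2 = 1 + p / 2 by ring]
  field_simp

lemma isoConstC'_pos (n : ℕ) : 0 < isoConstC' n := by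
  have : 0 < kernelConstant n ((2 * n + 2) / (2 * n + 1)) := kernelConstant_pos (by positivity)
  rw [isoConstC'_eq]; positivity

/-- The optimal level in the layer-cake bound. -/
lemma exists_level_eq_isoConstC' (n : ℕ) {a : ℝ} (ha : 0 < a) :
    ∃ t > 0, t * a + t ^ (1 - (2 * n + 2) / (2 * n + 1) : ℝ) * ((2 * n + 1) / (2 * n + 2)) *
      kernelConstant n ((2 * n + 2) / (2 * n + 1)) = isoConstC' n * a ^ (1 / (2 * n + 2) : ℝ) := by
  set p : ℝ := (2 * n + 2) / (2 * n + 1) with hp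
  have hp0 : 0 < p := by positivity
  have hK : 0 < kernelConstant n p := kernelConstant_pos hp0
  set K := kernelConstant n p
  have hQ : (0 : ℝ) < 2 * n + 2 := by positivity
  -- The critical point of `t a + t^(1-p) K (Q-1)/Q`, namely `t^p = K/(Q a)`; the value there is `t
  -- Q a`.
  refine ⟨(K / ((2 * n + 2) * a)) ^ (1 / p), by positivity, ?_⟩
  set t : ℝ := (K / ((2 * n + 2) * a)) ^ (1 / p) with ht
  have ht0 : 0 < t := by positivity
  have htp : t ^ p = K / ((2 * n + 2) * a) := by
    rw [ht, ← Real.rpow_mul (by positivity), one_div_mul_cancel hp0.ne', Real.rpow_one]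
  have h1 : t ^ (1 - p) * K = t * ((2 * n + 2) * a) := by
    rw [Real.rpow_sub ht0, Real.rpow_one, htp]; field_simp
  have h2 : t * a + t ^ (1 - p) * ((2 * n + 1) / (2 * n + 2)) * K = t * ((2 * n + 2) * a) := by
    rw [mul_right_comm, h1]; field_simp; ring
  have hpi : 1 / p = (2 * n + 1) / (2 * n + 2) := by rw [hp]; field_simp
  have hq : (1 : ℝ) / (2 * n + 2) = 1 - 1 / p := by rw [hpi]; field_simp; ring
  rw [h2, isoConstC'_eq, ← hp, ← hpi, hq, ht, Real.div_rpow hK.le (by positivity),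
    Real.mul_rpow hQ.le ha.le, Real.rpow_sub hQ, Real.rpow_sub ha, Real.rpow_one, Real.rpow_one]
  field_simp
  rfl

end KernelBound

/-! ### Differentiation under an integral with compactly supported weight. -/

section ParametricIntegral

variable {E F : Type*} [NormedAddCommGroup E] [NormedSpace ℝ E] [NormedAddCommGroup F]
  [NormedSpace ℝ F] {g : E → ℝ} {H : E × E → F}

lemma continuous_fderiv_right (hH : ContDiff ℝ 1 H) :
    Continuous fun q : E × E => fderiv ℝ (fun v => H (q.1, v)) q.2 := by
  have e : (fun q : E × E => fderiv ℝ (fun v => H (q.1, v)) q.2) =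
      fun q => (fderiv ℝ H q).comp (ContinuousLinearMap.inr ℝ E E) := by
    funext q
    exact ((hH.differentiable (by simp) q).hasFDerivAt.comp q.2
      (hasFDerivAt_prodMk_right q.1 q.2)).fderiv
  rw [e]
  exact (hH.continuous_fderiv (by simp)).clm_comp continuous_const

lemma continuous_fderiv_right_left (hH : ContDiff ℝ 1 H) (v : E) :
    Continuous fun u => fderiv ℝ (fun v => H (u, v)) v :=
  (continuous_fderiv_right hH).comp (continuous_id.prodMk continuous_const)

variable [FiniteDimensional ℝ E] [MeasurableSpace E] [BorelSpace E] {μ : Measure E}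
  [IsFiniteMeasureOnCompacts μ]

/-- Domination comes from compactness: the differentiated integrand vanishes off `tsupport g` and is
bounded on its product with a closed unit ball about `v`. -/
lemma hasFDerivAt_integral_smul (hg : Continuous g) (hgs : HasCompactSupport g)
    (hH : ContDiff ℝ 1 H) (v : E) :
    HasFDerivAt (fun v => ∫ u, g u • H (u, v) ∂μ)
      (∫ u, g u • fderiv ℝ (fun v => H (u, v)) v ∂μ) v := by
  have hD := continuous_fderiv_right hH
  have hK : IsCompact (tsupport g ×ˢ Metric.closedBall v 1) :=
    hgs.isCompact.prod (isCompact_closedBall v 1)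
  have hcont : Continuous fun q : E × E => g q.1 • fderiv ℝ (fun v => H (q.1, v)) q.2 :=
    (hg.comp continuous_fst).smul hD
  obtain ⟨M, hM⟩ := hK.exists_bound_of_continuousOn hcont.continuousOn
  have hFint : ∀ w, Continuous fun u => g u • H (u, w) := fun w =>
    hg.smul (hH.continuous.comp (by fun_prop))
  refine hasFDerivAt_integral_of_dominated_of_fderiv_le (s := Metric.closedBall v 1)
    (F := fun w u => g u • H (u, w)) (F' := fun w u => g u • fderiv ℝ (fun v => H (u, v)) w)
    (bound := (tsupport g).indicator fun _ => M) (Metric.closedBall_mem_nhds v one_pos)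
    (.of_forall fun w => (hFint w).aestronglyMeasurable) ?_ ?_ ?_ ?_ ?_
  · exact (hFint v).integrable_of_hasCompactSupport hgs.smul_right
  · exact (hcont.comp (by fun_prop : Continuous fun u => (u, v))).aestronglyMeasurable
  · refine .of_forall fun u w hw => ?_
    by_cases hu : u ∈ tsupport g
    · rw [Set.indicator_of_mem hu]
      exact hM (u, w) ⟨hu, hw⟩
    · rw [Set.indicator_of_notMem hu, image_eq_zero_of_notMem_tsupport hu, zero_smul, norm_zero]
  · rw [integrable_indicator_iff (isClosed_tsupport g).measurableSet]
    exact integrableOn_const hgs.isCompact.measure_lt_top.ne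
  · refine .of_forall fun u w _ => HasFDerivAt.const_smul ?_ (g u)
    have : Differentiable ℝ fun w => H (u, w) :=
      (hH.differentiable (by simp)).comp (by fun_prop : Differentiable ℝ fun w => (u, w))
    exact (this w).hasFDerivAt

lemma contDiff_integral_smul (hg : Continuous g) (hgs : HasCompactSupport g)
    (hH : ContDiff ℝ 1 H) : ContDiff ℝ 1 fun v => ∫ u, g u • H (u, v) ∂μ := by
  refine contDiff_one_iff_hasFDerivAt.2 ⟨_, ?_, hasFDerivAt_integral_smul hg hgs hH⟩
  have e : (fun v => ∫ u, g u • fderiv ℝ (fun v => H (u, v)) v ∂μ) =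
      fun v => ∫ u in tsupport g, g u • fderiv ℝ (fun v => H (u, v)) v ∂μ := by
    funext v
    refine (setIntegral_eq_integral_of_forall_compl_eq_zero fun u hu => ?_).symm
    rw [image_eq_zero_of_notMem_tsupport hu, zero_smul]
  rw [e]
  refine continuous_parametric_integral_of_continuous ?_ hgs.isCompact
  exact (hg.comp continuous_snd).smul ((continuous_fderiv_right hH).comp continuous_swap)

end ParametricIntegral

/-! ### The convolved field: divergence and sup bound. -/

section KernelConvolution

variable {n : ℕ} {g : HeisenbergSpace n → ℝ} {ε : ℝ}

/-- The horizontal divergence as a linear functional of the derivative. -/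
noncomputable def horizontalTrace (v : HeisenbergSpace n) :
    (HeisenbergSpace n →L[ℝ] EuclideanSpace ℝ (Fin n ⊕ Fin n)) →L[ℝ] ℝ :=
  ∑ j : Fin n, ((EuclideanSpace.proj (Sum.inl j)).comp
      (ContinuousLinearMap.apply ℝ (EuclideanSpace ℝ (Fin n ⊕ Fin n))
        ((Pi.single j 1, 0, 2 * v.2.1 j) : HeisenbergSpace n)) +
    (EuclideanSpace.proj (Sum.inr j)).comp
      (ContinuousLinearMap.apply ℝ (EuclideanSpace ℝ (Fin n ⊕ Fin n))
        ((0, Pi.single j 1, -2 * v.1 j) : HeisenbergSpace n)))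

lemma fderiv_euclidean_apply {φ : HeisenbergSpace n → EuclideanSpace ℝ (Fin n ⊕ Fin n)}
    {v : HeisenbergSpace n} (hφ : DifferentiableAt ℝ φ v) (i : Fin n ⊕ Fin n)
    (w : HeisenbergSpace n) : fderiv ℝ (fun q => φ q i) v w = fderiv ℝ φ v w i := by
  have h := ((EuclideanSpace.proj i : EuclideanSpace ℝ (Fin n ⊕ Fin n) →L[ℝ] ℝ).hasFDerivAt.comp v
    hφ.hasFDerivAt).fderiv
  exact congrArg (· w) h

lemma horizontalDiv_eq_trace {φ : HeisenbergSpace n → EuclideanSpace ℝ (Fin n ⊕ Fin n)}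
    {v : HeisenbergSpace n} (hφ : DifferentiableAt ℝ φ v) :
    horizontalDiv φ v = horizontalTrace v (fderiv ℝ φ v) := by
  simp only [horizontalDiv, heisenbergX, heisenbergY, fderiv_euclidean_apply hφ, horizontalTrace]
  simp

/-- The convolution of `g` with the kernel field. -/
noncomputable def kernelConvolution (ε : ℝ) (g : HeisenbergSpace n → ℝ) (v : HeisenbergSpace n) :
    EuclideanSpace ℝ (Fin n ⊕ Fin n) :=
  ∫ u, g u • kernelField ε (leftDiff u v)

lemma contDiff_kernelField_leftDiff (hε : 0 < ε) : ContDiff ℝ 1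
    fun q : HeisenbergSpace n × HeisenbergSpace n => kernelField ε (leftDiff q.1 q.2) :=
  (contDiff_kernelField (k := 1) hε).comp (contDiff_leftDiff (k := 1))

lemma contDiff_kernelConvolution (hε : 0 < ε) (hg : Continuous g) (hgs : HasCompactSupport g) :
    ContDiff ℝ 1 (kernelConvolution ε g) :=
  contDiff_integral_smul hg hgs (contDiff_kernelField_leftDiff hε)

/-- At fixed `v` the divergence is a continuous linear functional of the derivative, so it passes
under the integral; left invariance then evaluates it on each translate. -/
lemma horizontalDiv_kernelConvolution (hε : 0 < ε) (hg : Continuous g) (hgs : HasCompactSupport g)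
    (v : HeisenbergSpace n) :
    horizontalDiv (kernelConvolution ε g) v = ∫ u, g u * kernelDensity ε (leftDiff u v) := by
  have hH := contDiff_kernelField_leftDiff (n := n) hε
  have h : HasFDerivAt (kernelConvolution ε g)
      (∫ u, g u • fderiv ℝ (fun v => kernelField ε (leftDiff u v)) v) v :=
    hasFDerivAt_integral_smul hg hgs hH v
  rw [horizontalDiv_eq_trace h.differentiableAt]
  have hint : Integrable fun u => g u • fderiv ℝ (fun v => kernelField ε (leftDiff u v)) v := by
    have hc : Continuous fun u => fderiv ℝ (fun v => kernelField ε (leftDiff u v)) v :=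
      continuous_fderiv_right_left hH v
    exact (hg.smul hc).integrable_of_hasCompactSupport
      (hgs.smul_right (f' := fun u => fderiv ℝ (fun v => kernelField ε (leftDiff u v)) v))
  rw [h.fderiv, ← ContinuousLinearMap.integral_comp_comm _ hint]
  refine integral_congr_ae (.of_forall fun u => ?_)
  have hW : Differentiable ℝ (kernelField (n := n) ε) :=
    (contDiff_kernelField (k := 1) hε).differentiable (by simp)
  have hWu : Differentiable ℝ fun v => kernelField ε (leftDiff u v) :=
    hW.comp (differentiable_leftDiff u)
  simp only [map_smul, smul_eq_mul]
  rw [← horizontalDiv_eq_trace (hWu v), horizontalDiv_comp_leftDiff hW, horizontalDiv_kernelField hε]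

lemma continuous_leftDiff_left (v : HeisenbergSpace n) : Continuous fun u => leftDiff u v := by
  unfold leftDiff; fun_prop

lemma continuous_kernelField_leftDiff (hε : 0 < ε) (v : HeisenbergSpace n) :
    Continuous fun u => kernelField ε (leftDiff u v) :=
  (contDiff_kernelField (k := 0) hε).continuous.comp (continuous_leftDiff_left v)

lemma integral_mul_excess_le [NeZero n] (hε : 0 < ε) (hg : Continuous g)
    (hgs : HasCompactSupport g) (h0 : ∀ u, 0 ≤ g u) (h1 : ∀ u, g u ≤ 1)
    {e : EuclideanSpace ℝ (Fin n ⊕ Fin n)} {t B : ℝ} (hB0 : 0 ≤ B)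
    (hB : ∫⁻ w : HeisenbergSpace n, ENNReal.ofReal (inner ℝ e (kernelField ε w) - t) ≤
      ENNReal.ofReal B) (v : HeisenbergSpace n) :
    Integrable (fun u => g u * max (inner ℝ e (kernelField ε (leftDiff u v)) - t) 0) ∧
    ∫ u, g u * max (inner ℝ e (kernelField ε (leftDiff u v)) - t) 0 ≤ B := by
  have hk : Continuous fun u => inner ℝ e (kernelField ε (leftDiff u v)) :=
    continuous_const.inner (continuous_kernelField_leftDiff hε v)
  have hi3 : Integrable fun u => g u * max (inner ℝ e (kernelField ε (leftDiff u v)) - t) 0 :=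
    (hg.mul ((hk.sub continuous_const).max continuous_const)).integrable_of_hasCompactSupport
      hgs.mul_right
  refine ⟨hi3, ?_⟩
  rw [← ENNReal.ofReal_le_ofReal_iff hB0, ofReal_integral_eq_lintegral_ofReal hi3
    (.of_forall fun u => mul_nonneg (h0 u) (le_max_right _ _))]
  have hm : Measurable fun w : HeisenbergSpace n =>
      ENNReal.ofReal (inner ℝ e (kernelField ε w) - t) :=
    ((continuous_const.inner (contDiff_kernelField (k := 0) hε).continuous).sub
      continuous_const).measurable.ennreal_ofReal
  refine le_trans ?_ hB
  rw [← (measurePreserving_leftDiff v).lintegral_comp hm]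
  refine lintegral_mono fun u => ?_
  have e1 : ∀ x : ℝ, ENNReal.ofReal x = ENNReal.ofReal (max x 0) := fun x => by
    rw [ENNReal.ofReal_max, ENNReal.ofReal_zero, max_eq_left zero_le]
  rw [e1 (inner ℝ e (kernelField ε (leftDiff u v)) - t)]
  exact ENNReal.ofReal_le_ofReal (mul_le_of_le_one_left (le_max_right _ _) (h1 u))

/-- Layer-cake bound: integrate `k ≤ t + (k - t)₊` against `g`; the excess term costs at most `B`
because `g ≤ 1` and `u ↦ u⁻¹v` preserves volume. -/
lemma inner_kernelConvolution_le [NeZero n] (hε : 0 < ε) (hg : Continuous g)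
    (hgs : HasCompactSupport g) (h0 : ∀ u, 0 ≤ g u) (h1 : ∀ u, g u ≤ 1)
    {e : EuclideanSpace ℝ (Fin n ⊕ Fin n)} {t B : ℝ} (hB0 : 0 ≤ B)
    (hB : ∫⁻ w : HeisenbergSpace n, ENNReal.ofReal (inner ℝ e (kernelField ε w) - t) ≤
      ENNReal.ofReal B) (v : HeisenbergSpace n) :
    inner ℝ e (kernelConvolution ε g v) ≤ t * (∫ u, g u) + B := by
  obtain ⟨hi3, hex⟩ := integral_mul_excess_le hε hg hgs h0 h1 hB0 hB v
  have hW := continuous_kernelField_leftDiff hε v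
  have hint : Integrable fun u => g u • kernelField ε (leftDiff u v) :=
    (hg.smul hW).integrable_of_hasCompactSupport hgs.smul_right
  have hk : Continuous fun u => inner ℝ e (kernelField ε (leftDiff u v)) :=
    continuous_const.inner hW
  have hi1 : Integrable g := hg.integrable_of_hasCompactSupport hgs
  have hi2 : Integrable fun u => g u * inner ℝ e (kernelField ε (leftDiff u v)) :=
    (hg.mul hk).integrable_of_hasCompactSupport hgs.mul_right
  rw [kernelConvolution, ← integral_inner hint]
  simp only [real_inner_smul_right]
  refine le_trans ?_ (add_le_add le_rfl hex)
  rw [← integral_const_mul, ← integral_add (hi1.const_mul t) hi3]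
  refine integral_mono hi2 ((hi1.const_mul t).add hi3) fun u => ?_
  have := mul_le_mul_of_nonneg_left
    (le_max_left (inner ℝ e (kernelField ε (leftDiff u v)) - t) 0) (h0 u)
  simp only
  linarith

lemma norm_kernelConvolution_le [NeZero n] (hε : 0 < ε) (hg : Continuous g)
    (hgs : HasCompactSupport g) (h0 : ∀ u, 0 ≤ g u) (h1 : ∀ u, g u ≤ 1) {a : ℝ} (ha : 0 < a)
    (hga : ∫ u, g u ≤ a) (v : HeisenbergSpace n) :
    ‖kernelConvolution ε g v‖ ≤ isoConstC' n * a ^ (1 / (2 * n + 2) : ℝ) := by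
  obtain ⟨t, ht, hopt⟩ := exists_level_eq_isoConstC' n ha
  have hM : 0 < isoConstC' n * a ^ (1 / (2 * n + 2) : ℝ) :=
    mul_pos (isoConstC'_pos n) (Real.rpow_pos_of_pos ha _)
  have hB0 : 0 ≤ t ^ (1 - (2 * n + 2) / (2 * n + 1) : ℝ) * ((2 * n + 1) / (2 * n + 2)) *
      kernelConstant n ((2 * n + 2) / (2 * n + 1)) := by
    have : 0 < kernelConstant n ((2 * n + 2) / (2 * n + 1)) := kernelConstant_pos (by positivity)
    positivity
  have key : ∀ e : EuclideanSpace ℝ (Fin n ⊕ Fin n), ‖e‖ = 1 →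
      inner ℝ e (kernelConvolution ε g v) ≤ isoConstC' n * a ^ (1 / (2 * n + 2) : ℝ) := by
    intro e he
    rw [← hopt]
    exact (inner_kernelConvolution_le hε hg hgs h0 h1 hB0
      (lintegral_inner_kernelField_excess_le he hε ht) v).trans
      (add_le_add (mul_le_mul_of_nonneg_left hga ht.le) le_rfl)
  rcases eq_or_ne (kernelConvolution ε g v) 0 with hz | hz
  · rw [hz, norm_zero]; exact hM.le
  · have h := key (‖kernelConvolution ε g v‖⁻¹ • kernelConvolution ε g v)
      (norm_smul_inv_norm (𝕜 := ℝ) hz)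
    rwa [real_inner_smul_left, real_inner_self_eq_norm_sq, sq,
      inv_mul_cancel_left₀ (norm_ne_zero_iff.2 hz)] at h

end KernelConvolution

/-! ### Cutoffs and admissible test fields. -/

section Perimeter

variable {n : ℕ}

lemma heisenbergX_mul (j : Fin n) {η f : HeisenbergSpace n → ℝ} {v : HeisenbergSpace n}
    (hη : DifferentiableAt ℝ η v) (hf : DifferentiableAt ℝ f v) :
    heisenbergX j (fun q => η q * f q) v = η v * heisenbergX j f v + f v * heisenbergX j η v := by
  simp [heisenbergX, fderiv_fun_mul hη hf]

lemma heisenbergY_mul (j : Fin n) {η f : HeisenbergSpace n → ℝ} {v : HeisenbergSpace n}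
    (hη : DifferentiableAt ℝ η v) (hf : DifferentiableAt ℝ f v) :
    heisenbergY j (fun q => η q * f q) v = η v * heisenbergY j f v + f v * heisenbergY j η v := by
  simp [heisenbergY, fderiv_fun_mul hη hf]

lemma horizontalDiv_smul {η : HeisenbergSpace n → ℝ}
    {φ : HeisenbergSpace n → EuclideanSpace ℝ (Fin n ⊕ Fin n)} (hη : Differentiable ℝ η)
    (hφ : Differentiable ℝ φ) (v : HeisenbergSpace n) :
    horizontalDiv (fun q => η q • φ q) v = η v * horizontalDiv φ v +
      ∑ j, (φ v (Sum.inl j) * heisenbergX j η v + φ v (Sum.inr j) * heisenbergY j η v) := by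
  have h : ∀ i, DifferentiableAt ℝ (fun w => φ w i) v := fun i => by fun_prop
  simp only [horizontalDiv, PiLp.smul_apply, smul_eq_mul, heisenbergX_mul _ (hη v) (h _),
    heisenbergY_mul _ (hη v) (h _)]
  rw [Finset.mul_sum, ← Finset.sum_add_distrib]
  exact Finset.sum_congr rfl fun j _ => by ring

lemma continuous_heisenbergX (j : Fin n) {f : HeisenbergSpace n → ℝ} (hf : ContDiff ℝ 1 f) :
    Continuous (heisenbergX j f) :=
  (hf.continuous_fderiv (by simp)).clm_apply (by fun_prop)

lemma continuous_heisenbergY (j : Fin n) {f : HeisenbergSpace n → ℝ} (hf : ContDiff ℝ 1 f) :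
    Continuous (heisenbergY j f) :=
  (hf.continuous_fderiv (by simp)).clm_apply (by fun_prop)

lemma continuous_horizontalDiv {φ : HeisenbergSpace n → EuclideanSpace ℝ (Fin n ⊕ Fin n)}
    (hφ : ContDiff ℝ 1 φ) : Continuous (horizontalDiv φ) := by
  have h := contDiff_euclidean.1 hφ
  exact continuous_finsetSum _ fun j _ =>
    (continuous_heisenbergX j (h _)).add (continuous_heisenbergY j (h _))

lemma contDiff_heisenbergDilation (s : ℝ) : ContDiff ℝ 1 (heisenbergDilation (n := n) s) := by
  unfold heisenbergDilation; fun_prop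

lemma fderiv_heisenbergDilation (s : ℝ) (v w : HeisenbergSpace n) :
    fderiv ℝ (heisenbergDilation s) v w = heisenbergDilation s w := by
  let L : HeisenbergSpace n →ₗ[ℝ] HeisenbergSpace n :=
    { toFun := heisenbergDilation s
      map_add' := fun a b => by ext <;> simp [heisenbergDilation] <;> ring
      map_smul' := fun c a => by ext <;> simp [heisenbergDilation] <;> ring }
  have h : HasFDerivAt (heisenbergDilation s) L.toContinuousLinearMap v :=
    L.toContinuousLinearMap.hasFDerivAt
  rw [h.fderiv]; rfl

lemma heisenbergX_comp_dilation (j : Fin n) {η : HeisenbergSpace n → ℝ} (hη : Differentiable ℝ η)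
    (s : ℝ) (v : HeisenbergSpace n) :
    heisenbergX j (fun q => η (heisenbergDilation s q)) v =
      s * heisenbergX j η (heisenbergDilation s v) := by
  rw [heisenbergX, heisenbergX, fderiv_fun_comp v (hη _)
    ((contDiff_heisenbergDilation s).differentiable (by simp) v), ContinuousLinearMap.comp_apply,
    fderiv_heisenbergDilation, ← smul_eq_mul s, ← map_smul]
  congr 1
  ext <;> simp [heisenbergDilation] <;> ring

lemma heisenbergY_comp_dilation (j : Fin n) {η : HeisenbergSpace n → ℝ} (hη : Differentiable ℝ η)
    (s : ℝ) (v : HeisenbergSpace n) :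
    heisenbergY j (fun q => η (heisenbergDilation s q)) v =
      s * heisenbergY j η (heisenbergDilation s v) := by
  rw [heisenbergY, heisenbergY, fderiv_fun_comp v (hη _)
    ((contDiff_heisenbergDilation s).differentiable (by simp) v), ContinuousLinearMap.comp_apply,
    fderiv_heisenbergDilation, ← smul_eq_mul s, ← map_smul]
  congr 1
  ext <;> simp [heisenbergDilation] <;> ring

lemma heisenbergDilation_dilation_inv {s : ℝ} (hs : s ≠ 0) (v : HeisenbergSpace n) :
    heisenbergDilation s (heisenbergDilation s⁻¹ v) = v := by
  ext <;> simp [heisenbergDilation] <;> field_simp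

lemma norm_heisenbergDilation_le {s : ℝ} (h0 : 0 ≤ s) (h1 : s ≤ 1) (v : HeisenbergSpace n) :
    ‖heisenbergDilation s v‖ ≤ s * ‖v‖ := by
  have h2 : ‖v.1‖ ≤ ‖v‖ := norm_fst_le v
  have h3 : ‖v.2.1‖ ≤ ‖v‖ := (norm_fst_le v.2).trans (norm_snd_le v)
  have h4 : ‖v.2.2‖ ≤ ‖v‖ := (norm_snd_le v.2).trans (norm_snd_le v)
  rw [heisenbergDilation, Prod.norm_def, Prod.norm_def]
  refine max_le ?_ (max_le ?_ ?_)
  · rw [norm_smul, Real.norm_of_nonneg h0]; gcongr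
  · rw [norm_smul, Real.norm_of_nonneg h0]; gcongr
  · rw [norm_mul, Real.norm_of_nonneg (by positivity)]
    exact mul_le_mul (by nlinarith) h4 (norm_nonneg _) h0

/-- Cutoff functions on the Heisenberg group whose horizontal gradient is arbitrarily small. -/
lemma exists_cutoff {K : Set (HeisenbergSpace n)} (hK : IsCompact K) {δ : ℝ} (hδ : 0 < δ) :
    ∃ η : HeisenbergSpace n → ℝ, ContDiff ℝ 1 η ∧ HasCompactSupport η ∧ (∀ v, 0 ≤ η v) ∧
      (∀ v, η v ≤ 1) ∧ (∀ v ∈ K, η v = 1) ∧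
      ∀ j v, |heisenbergX j η v| ≤ δ ∧ |heisenbergY j η v| ≤ δ := by
  let b : ContDiffBump (0 : HeisenbergSpace n) := ⟨1, 2, one_pos, one_lt_two⟩
  have hb : ContDiff ℝ 1 b := b.contDiff
  have hbs : HasCompactSupport b := b.hasCompactSupport
  have hbd : ∀ j, ∃ C, ∀ v, |heisenbergX j b v| ≤ C ∧ |heisenbergY j b v| ≤ C := by
    intro j
    have hsup : ∀ w : HeisenbergSpace n → HeisenbergSpace n,
        HasCompactSupport fun v => fderiv ℝ b v (w v) := fun w =>
      (hbs.fderiv ℝ).mono' fun v hv => subset_tsupport _ fun h0 => hv (by simp only [h0]; rfl)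
    obtain ⟨C, hC⟩ := (hsup _).exists_bound_of_continuous (continuous_heisenbergX j hb)
    obtain ⟨D, hD⟩ := (hsup _).exists_bound_of_continuous (continuous_heisenbergY j hb)
    exact ⟨max C D, fun v => ⟨(hC v).trans (le_max_left _ _), (hD v).trans (le_max_right _ _)⟩⟩
  choose C hC using hbd
  obtain ⟨r, hr⟩ := hK.isBounded.exists_norm_le
  set D : ℝ := ∑ j, |C j| with hD
  -- Large enough for the dilated bump to equal 1 on `K` (`R ≥ r`) and for its horizontal
  -- derivatives to be at most `D / R ≤ δ`.
  set R : ℝ := 1 + |r| + D / δ with hR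
  have hD0 : 0 ≤ D := Finset.sum_nonneg fun _ _ => abs_nonneg _
  have hDδ : 0 ≤ D / δ := div_nonneg hD0 hδ.le
  have hR1 : 1 ≤ R := by linarith [abs_nonneg r]
  have hR0 : 0 < R := by linarith
  have hRi : R⁻¹ ≤ 1 := inv_le_one_of_one_le₀ hR1
  have hCR : ∀ j, R⁻¹ * C j ≤ δ := by
    intro j
    have h1 : C j ≤ D := (le_abs_self _).trans
      (Finset.single_le_sum (f := fun j => |C j|) (fun _ _ => abs_nonneg _) (Finset.mem_univ j))
    have h2 : D ≤ R * δ := by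
      rw [← div_le_iff₀ hδ]; linarith [abs_nonneg r]
    rw [inv_mul_le_iff₀ hR0]; linarith
  -- The dilation must be the homogeneous one, for which `X_j` and `Y_j` gain a factor `R⁻¹`; under
  -- Euclidean scaling the terms `y_j ∂_z` and `x_j ∂_z` would not become small.
  refine ⟨fun v => b (heisenbergDilation R⁻¹ v), hb.comp (contDiff_heisenbergDilation _), ?_,
    fun v => b.nonneg, fun v => b.le_one, fun v hv => ?_, fun j v => ?_⟩
  · refine HasCompactSupport.intro
      (hbs.isCompact.image (contDiff_heisenbergDilation R).continuous) fun v hv => ?_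
    by_contra h
    exact hv ⟨_, subset_tsupport _ h, heisenbergDilation_dilation_inv hR0.ne' v⟩
  · refine b.one_of_mem_closedBall (mem_closedBall_zero_iff.2 ?_)
    refine (norm_heisenbergDilation_le (inv_nonneg.2 hR0.le) hRi v).trans ?_
    rw [inv_mul_le_iff₀ hR0]
    change ‖v‖ ≤ R * 1
    linarith [hr v hv, le_abs_self r]
  · rw [heisenbergX_comp_dilation j (hb.differentiable (by simp)),
      heisenbergY_comp_dilation j (hb.differentiable (by simp)), abs_mul, abs_mul,
      abs_of_pos (inv_pos.2 hR0)]
    have h := hC j (heisenbergDilation R⁻¹ v)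
    exact ⟨(mul_le_mul_of_nonneg_left h.1 (inv_nonneg.2 hR0.le)).trans (hCR j),
      (mul_le_mul_of_nonneg_left h.2 (inv_nonneg.2 hR0.le)).trans (hCR j)⟩

lemma le_horizontalPerimeter {E : Set (HeisenbergSpace n)}
    {φ : HeisenbergSpace n → EuclideanSpace ℝ (Fin n ⊕ Fin n)} (hφ : ContDiff ℝ 1 φ)
    (hφs : HasCompactSupport φ) {M : ℝ} (hM : 0 < M) (hφM : ∀ v, ‖φ v‖ ≤ M) :
    ENNReal.ofReal (∫ v in E, horizontalDiv φ v) ≤ ENNReal.ofReal M * horizontalPerimeter E := by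
  have htest : IsPerimeterTestField fun v => M⁻¹ • φ v :=
    ⟨(contDiff_const (c := M⁻¹)).smul hφ, hφs.smul_left (f := fun _ => M⁻¹) (f' := φ), fun v => by
      rw [norm_smul, Real.norm_of_nonneg (inv_nonneg.2 hM.le), inv_mul_le_iff₀ hM, mul_one]
      exact hφM v⟩
  have h := le_iSup₂ (f := fun (φ : HeisenbergSpace n → EuclideanSpace ℝ (Fin n ⊕ Fin n))
    (_ : IsPerimeterTestField φ) => ENNReal.ofReal (∫ p in E, horizontalDiv φ p)) _ htest
  have hdiv : ∀ v, horizontalDiv (fun v => M⁻¹ • φ v) v = M⁻¹ * horizontalDiv φ v := by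
    intro v
    rw [horizontalDiv_smul (η := fun _ => M⁻¹) (by fun_prop) (hφ.differentiable (by simp))]
    simp [heisenbergX, heisenbergY]
  simp only [hdiv, integral_const_mul] at h
  have hI : ∫ v in E, horizontalDiv φ v = M * (M⁻¹ * ∫ v in E, horizontalDiv φ v) := by
    rw [mul_inv_cancel_left₀ hM.ne']
  rw [hI, ENNReal.ofReal_mul hM.le]
  exact mul_le_mul_right h _

/-- Test with `η φ` for a cutoff `η`: the term with derivatives of `η` is uniformly small and `E`
has finite volume, while nonnegativity of the divergence allows the main term to be restricted from
`E` to `K`. -/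
lemma le_horizontalPerimeter_of_div_nonneg {E K : Set (HeisenbergSpace n)}
    (hfin : volume E < ∞) (hK : IsCompact K) (hKE : K ⊆ E)
    {φ : HeisenbergSpace n → EuclideanSpace ℝ (Fin n ⊕ Fin n)} (hφ : ContDiff ℝ 1 φ)
    {M : ℝ} (hM : 0 < M) (hφM : ∀ v, ‖φ v‖ ≤ M) (hdiv : ∀ v, 0 ≤ horizontalDiv φ v) :
    ENNReal.ofReal (∫ v in K, horizontalDiv φ v) ≤ ENNReal.ofReal M * horizontalPerimeter E := by
  refine ENNReal.le_of_forall_pos_le_add fun τ hτ _ => ?_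
  set c : ℝ := volume.real E * (n * (M + M)) with hc
  have hc0 : 0 ≤ c := by positivity
  -- The error integral is at most `c` times the gradient bound; the `+ 1` covers `c = 0`.
  obtain ⟨η, hη, hηs, hη0, hη1, hηK, hηd⟩ := exists_cutoff hK
    (show (0 : ℝ) < τ / (c + 1) by positivity)
  set δ : ℝ := τ / (c + 1) with hδ
  have hδ0 : 0 < δ := by positivity
  have hψ : ContDiff ℝ 1 fun v => η v • φ v := hη.smul hφ
  have hψs : HasCompactSupport fun v => η v • φ v := hηs.smul_right (f' := φ)
  have hψM : ∀ v, ‖η v • φ v‖ ≤ M := fun v => by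
    rw [norm_smul, Real.norm_of_nonneg (hη0 v)]
    exact (mul_le_of_le_one_left (norm_nonneg _) (hη1 v)).trans (hφM v)
  have hηc : Continuous fun v => η v * horizontalDiv φ v :=
    hη.continuous.mul (continuous_horizontalDiv hφ)
  have i1 : Integrable fun v => η v * horizontalDiv φ v :=
    hηc.integrable_of_hasCompactSupport (hηs.mul_right (f' := horizontalDiv φ))
  let err : HeisenbergSpace n → ℝ := fun v =>
    horizontalDiv (fun q => η q • φ q) v - η v * horizontalDiv φ v
  have herrc : Continuous err := (continuous_horizontalDiv hψ).sub hηc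
  have herr : ∀ v, ‖err v‖ ≤ n * (M + M) * δ := by
    intro v
    have hcomp : ∀ i, |φ v i| ≤ M := fun i => (PiLp.norm_apply_le (φ v) i).trans (hφM v)
    simp only [err, horizontalDiv_smul (hη.differentiable (by simp)) (hφ.differentiable (by simp)),
      add_sub_cancel_left]
    refine (norm_sum_le _ _).trans ?_
    calc _ ≤ ∑ _j : Fin n, (M * δ + M * δ) := by
          refine Finset.sum_le_sum fun j _ => (norm_add_le _ _).trans ?_
          rw [norm_mul, norm_mul]
          exact add_le_add
            (mul_le_mul (hcomp _) (hηd j v).1 (abs_nonneg _) hM.le)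
            (mul_le_mul (hcomp _) (hηd j v).2 (abs_nonneg _) hM.le)
      _ = n * (M + M) * δ := by simp; ring
  have i2 : IntegrableOn err E :=
    Measure.integrableOn_of_bounded hfin.ne herrc.aestronglyMeasurable (.of_forall herr)
  have e1 : ∫ v in E, horizontalDiv (fun q => η q • φ q) v =
      (∫ v in E, η v * horizontalDiv φ v) + ∫ v in E, err v := by
    rw [← integral_add i1.integrableOn i2]
    exact integral_congr_ae (.of_forall fun v => by simp only [err]; ring)
  have e2 : ∫ v in K, horizontalDiv φ v ≤ ∫ v in E, η v * horizontalDiv φ v := by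
    rw [setIntegral_congr_fun (g := fun v => η v * horizontalDiv φ v) hK.measurableSet
      fun v hv => by simp only [hηK v hv, one_mul]]
    exact setIntegral_mono_set i1.integrableOn (.of_forall fun v => mul_nonneg (hη0 v) (hdiv v))
      (.of_forall hKE)
  have e3 : -(τ : ℝ) ≤ ∫ v in E, err v := by
    have h := norm_setIntegral_le_of_norm_le_const hfin (C := n * (M + M) * δ) fun v _ => herr v
    have h2 : n * (M + M) * δ * volume.real E ≤ τ := by
      have : n * (M + M) * δ * volume.real E = c * δ := by rw [hc]; ring
      rw [this, hδ, mul_div_assoc', div_le_iff₀ (by positivity)]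
      nlinarith [τ.2]
    exact (abs_le.1 (h.trans h2)).1
  calc ENNReal.ofReal (∫ v in K, horizontalDiv φ v)
      ≤ ENNReal.ofReal ((∫ v in E, horizontalDiv (fun q => η q • φ q) v) + τ) :=
        ENNReal.ofReal_le_ofReal (by linarith)
    _ ≤ ENNReal.ofReal (∫ v in E, horizontalDiv (fun q => η q • φ q) v) + ENNReal.ofReal τ :=
        ENNReal.ofReal_add_le
    _ ≤ ENNReal.ofReal M * horizontalPerimeter E + τ := by
        rw [ENNReal.ofReal_coe_nnreal]
        exact add_le_add (le_horizontalPerimeter hψ hψs hM hψM) le_rfl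

end Perimeter

/-! ### The divergence as an approximate identity. -/

section ApproximateIdentity

variable {n : ℕ} {g : HeisenbergSpace n → ℝ} {ε : ℝ}

/-- The product `v w⁻¹` in the Heisenberg group. -/
def rightDiff (w v : HeisenbergSpace n) : HeisenbergSpace n :=
  (v.1 - w.1, v.2.1 - w.2.1,
    v.2.2 - w.2.2 + 2 * ∑ j, (w.2.1 j * v.1 j - w.1 j * v.2.1 j))

lemma rightDiff_leftDiff (u v : HeisenbergSpace n) : rightDiff (leftDiff u v) v = u := by
  refine Prod.ext ?_ (Prod.ext ?_ ?_)
  · simp [rightDiff, leftDiff]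
  · simp [rightDiff, leftDiff]
  · have : ∑ j, ((v.2.1 j - u.2.1 j) * v.1 j - (v.1 j - u.1 j) * v.2.1 j) =
        -∑ j, (u.2.1 j * v.1 j - u.1 j * v.2.1 j) := by
      rw [← Finset.sum_neg_distrib]
      exact Finset.sum_congr rfl fun j _ => by ring
    simp only [rightDiff, leftDiff, Pi.sub_apply, this]
    ring

lemma continuous_rightDiff :
    Continuous fun q : HeisenbergSpace n × HeisenbergSpace n => rightDiff q.1 q.2 := by
  unfold rightDiff; fun_prop

lemma rightDiff_zero (v : HeisenbergSpace n) : rightDiff 0 v = v := by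
  ext <;> simp [rightDiff]

lemma kernelDensity_dilation (hε : 0 < ε) (w : HeisenbergSpace n) :
    kernelDensity ε (heisenbergDilation ε w) = (ε ^ (2 * n + 2))⁻¹ * kernelDensity 1 w := by
  have h1 : regularizedGauge ε (heisenbergDilation ε w) = ε ^ 4 * regularizedGauge 1 w := by
    rw [regularizedGauge, regularizedGauge, horizontalSq_dilation]
    simp only [heisenbergDilation]; ring
  have h2 : (ε ^ 4) ^ (-((n : ℝ) / 2 + 1)) = (ε ^ (2 * n + 4))⁻¹ := by
    rw [← Real.rpow_natCast, ← Real.rpow_mul hε.le, ← Real.rpow_natCast, ← Real.rpow_neg hε.le]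
    congr 1; push_cast; ring
  rw [kernelDensity, h1, Real.mul_rpow (by positivity) (regularizedGauge_pos one_pos w).le, h2,
    kernelDensity, show 2 * n + 4 = 2 * n + 2 + 2 by ring, pow_add ε (2 * n + 2) 2]
  field_simp

lemma lintegral_mul_kernelDensity (hε : 0 < ε) {F : HeisenbergSpace n → ℝ≥0∞} (hF : Measurable F) :
    ∫⁻ w, F w * ENNReal.ofReal (kernelDensity ε w) =
      ∫⁻ w, F (heisenbergDilation ε w) * ENNReal.ofReal (kernelDensity 1 w) := by
  have hm : Measurable fun w : HeisenbergSpace n => F w * ENNReal.ofReal (kernelDensity ε w) :=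
    hF.mul (continuous_kernelDensity hε).measurable.ennreal_ofReal
  have h := lintegral_comp_dilation hε hm
  have e : ∀ w : HeisenbergSpace n, F (heisenbergDilation ε w) *
      ENNReal.ofReal (kernelDensity ε (heisenbergDilation ε w)) =
      ENNReal.ofReal ((ε ^ (2 * n + 2))⁻¹) *
        (F (heisenbergDilation ε w) * ENNReal.ofReal (kernelDensity 1 w)) := by
    intro w
    rw [kernelDensity_dilation hε, ENNReal.ofReal_mul (by positivity)]; ring
  rw [lintegral_congr e, lintegral_const_mul' _ _ ENNReal.ofReal_ne_top] at h
  refine (ENNReal.mul_right_inj ?_ ENNReal.ofReal_ne_top).1 h.symm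
  rw [Ne, ENNReal.ofReal_eq_zero, not_le]; positivity

/-- Substituting `w = u⁻¹v` and then dilating by `ε` moves all dependence on `ε` into the argument
of `g`, leaving the fixed density `kernelDensity 1`. -/
lemma ofReal_setIntegral_div_kernelConvolution (hε : 0 < ε) (hg : Continuous g)
    (hgs : HasCompactSupport g) (h0 : ∀ u, 0 ≤ g u) {K : Set (HeisenbergSpace n)}
    (hK : IsCompact K) :
    ENNReal.ofReal (∫ v in K, horizontalDiv (kernelConvolution ε g) v) =
      ∫⁻ v in K, ∫⁻ w, ENNReal.ofReal (g (rightDiff (heisenbergDilation ε w) v)) *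
        ENNReal.ofReal (kernelDensity 1 w) := by
  have hc := continuous_horizontalDiv (contDiff_kernelConvolution hε hg hgs)
  have hnn : ∀ v, 0 ≤ horizontalDiv (kernelConvolution ε g) v := fun v => by
    rw [horizontalDiv_kernelConvolution hε hg hgs]
    exact integral_nonneg fun u => mul_nonneg (h0 u) (kernelDensity_nonneg _ _)
  rw [ofReal_integral_eq_lintegral_ofReal (hc.continuousOn.integrableOn_compact hK)
    (.of_forall hnn)]
  refine lintegral_congr fun v => ?_
  have hck : Continuous fun u => kernelDensity ε (leftDiff u v) :=
    (continuous_kernelDensity hε).comp (continuous_leftDiff_left v)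
  have hi : Integrable fun u => g u * kernelDensity ε (leftDiff u v) :=
    (hg.mul hck).integrable_of_hasCompactSupport
      (hgs.mul_right (f' := fun u => kernelDensity ε (leftDiff u v)))
  have hgr : Measurable fun w => ENNReal.ofReal (g (rightDiff w v)) :=
    (hg.comp (continuous_rightDiff.comp
      (continuous_id.prodMk continuous_const))).measurable.ennreal_ofReal
  have hm : Measurable fun w => ENNReal.ofReal (g (rightDiff w v)) *
      ENNReal.ofReal (kernelDensity ε w) :=
    hgr.mul (continuous_kernelDensity hε).measurable.ennreal_ofReal
  rw [← lintegral_mul_kernelDensity hε hgr, horizontalDiv_kernelConvolution hε hg hgs,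
    ofReal_integral_eq_lintegral_ofReal hi
      (.of_forall fun u => mul_nonneg (h0 u) (kernelDensity_nonneg _ _)),
    ← (measurePreserving_leftDiff v).lintegral_comp hm]
  refine lintegral_congr fun u => ?_
  rw [rightDiff_leftDiff, ENNReal.ofReal_mul (h0 u)]

/-- As `ε → 0` the integrand converges pointwise to `g(v)` times the density. Only a lower bound on
the liminf is needed, so Fatou suffices. -/
lemma le_of_forall_setIntegral_div_le (hn : 1 ≤ n) (hg : Continuous g) (hgs : HasCompactSupport g)
    (h0 : ∀ u, 0 ≤ g u) {K : Set (HeisenbergSpace n)} (hK : IsCompact K) (hgK : ∀ v ∈ K, g v = 1)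
    {B : ℝ≥0∞} (hB : ∀ ε > 0,
      ENNReal.ofReal (∫ v in K, horizontalDiv (kernelConvolution ε g) v) ≤ B) :
    ENNReal.ofReal (isoConstC n)⁻¹ * volume K ≤ B := by
  let e : ℕ → ℝ := fun k => 1 / ((k : ℝ) + 1)
  have he : ∀ k, 0 < e k := fun k => by positivity
  have he0 : Filter.Tendsto e Filter.atTop (nhds 0) := tendsto_one_div_add_atTop_nhds_zero_nat
  have hdil : Continuous fun q : ℝ × HeisenbergSpace n => heisenbergDilation q.1 q.2 := by
    unfold heisenbergDilation; fun_prop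
  let f : ℝ → HeisenbergSpace n × HeisenbergSpace n → ℝ≥0∞ := fun s q =>
    ENNReal.ofReal (g (rightDiff (heisenbergDilation s q.2) q.1)) *
      ENNReal.ofReal (kernelDensity 1 q.2)
  have hcg : ∀ s, Continuous fun q : HeisenbergSpace n × HeisenbergSpace n =>
      g (rightDiff (heisenbergDilation s q.2) q.1) := fun s =>
    hg.comp (continuous_rightDiff.comp
      ((hdil.comp (continuous_const.prodMk continuous_snd)).prodMk continuous_fst))
  have hfm : ∀ s, Measurable (f s) := fun s =>
    (hcg s).measurable.ennreal_ofReal.mul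
      ((continuous_kernelDensity one_pos).measurable.comp measurable_snd).ennreal_ofReal
  have hlim : ∀ q, Filter.Tendsto (fun k => f (e k) q) Filter.atTop (nhds (f 0 q)) := by
    intro q
    have h1 : Continuous fun s : ℝ => g (rightDiff (heisenbergDilation s q.2) q.1) :=
      hg.comp (continuous_rightDiff.comp
        ((hdil.comp (continuous_id.prodMk continuous_const)).prodMk continuous_const))
    have h2 := (h1.tendsto 0).comp he0
    exact ENNReal.Tendsto.mul_const (ENNReal.tendsto_ofReal h2) (Or.inr ENNReal.ofReal_ne_top)
  let μ : Measure (HeisenbergSpace n × HeisenbergSpace n) := (volume.restrict K).prod volume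
  have hle : ∀ k, ∫⁻ q, f (e k) q ∂μ ≤ B := by
    intro k
    rw [lintegral_prod _ (hfm _).aemeasurable]
    refine le_of_eq_of_le ?_ (hB (e k) (he k))
    rw [ofReal_setIntegral_div_kernelConvolution (he k) hg hgs h0 hK]
  have hlimint : ∫⁻ q, f 0 q ∂μ = ENNReal.ofReal (isoConstC n)⁻¹ * volume K := by
    rw [lintegral_prod _ (hfm _).aemeasurable]
    have h3 : ∀ v ∈ K, ∫⁻ w, f 0 (v, w) = ENNReal.ofReal (isoConstC n)⁻¹ := by
      intro v hv
      rw [← lintegral_kernelDensity_one hn]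
      refine lintegral_congr fun w => ?_
      have h4 : heisenbergDilation 0 w = 0 := by ext <;> simp [heisenbergDilation]
      simp only [f, h4, rightDiff_zero, hgK v hv, ENNReal.ofReal_one, one_mul]
    rw [setLIntegral_congr_fun hK.measurableSet h3, setLIntegral_const]
  rw [← hlimint]
  calc ∫⁻ q, f 0 q ∂μ = ∫⁻ q, Filter.liminf (fun k => f (e k) q) Filter.atTop ∂μ :=
        lintegral_congr fun q => (hlim q).liminf_eq.symm
    _ ≤ Filter.liminf (fun k => ∫⁻ q, f (e k) q ∂μ) Filter.atTop :=
        lintegral_liminf_le fun k => hfm _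
    _ ≤ Filter.liminf (fun _ : ℕ => B) Filter.atTop :=
        Filter.liminf_le_liminf (.of_forall hle)
    _ = B := Filter.liminf_const B

end ApproximateIdentity

/-! ### The isoperimetric inequality. -/

section Isoperimetric

variable {n : ℕ}

lemma isoConstC_pos (hn : 1 ≤ n) : 0 < isoConstC n := by
  have : (0 : ℝ) < n := by exact_mod_cast hn
  have := Real.Gamma_pos_of_pos (show (0 : ℝ) < n / 2 by positivity)
  unfold isoConstC; positivity

lemma mul_volume_le_of_isCompact (hn : 1 ≤ n) {E K : Set (HeisenbergSpace n)}
    (hfin : volume E < ∞) (hK : IsCompact K) (hKE : K ⊆ E) {a : ℝ} (ha : 0 < a)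
    (hEa : volume E < ENNReal.ofReal a) :
    ENNReal.ofReal (isoConstC n)⁻¹ * volume K ≤
      ENNReal.ofReal (isoConstC' n * a ^ (1 / (2 * n + 2) : ℝ)) * horizontalPerimeter E := by
  have : NeZero n := ⟨by omega⟩
  -- The neighbourhood `U` of `K` may leave `E`; only its volume matters, since `g` enters the sup
  -- bound through `∫ g ≤ |U| < a`.
  obtain ⟨U, hKU, hU, hUa⟩ := K.exists_isOpen_lt_of_lt _ ((measure_mono hKE).trans_lt hEa)
  obtain ⟨g, hgK, hgU, hgs, hg01⟩ := exists_continuous_one_zero_of_isCompact hK hU.isClosed_compl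
    (Set.disjoint_compl_right_iff_subset.2 hKU)
  have hg : Continuous g := g.continuous
  have hga : ∫ u, g u ≤ a := by
    rw [← ENNReal.ofReal_le_ofReal_iff ha.le]
    exact (integral_le_measure (fun x _ => (hg01 x).2) fun x hx => (hgU hx).le).trans hUa.le
  have hM : 0 < isoConstC' n * a ^ (1 / (2 * n + 2) : ℝ) :=
    mul_pos (isoConstC'_pos n) (Real.rpow_pos_of_pos ha _)
  refine le_of_forall_setIntegral_div_le hn hg hgs (fun u => (hg01 u).1) hK (fun v hv => hgK hv)
    fun ε hε => ?_
  refine le_horizontalPerimeter_of_div_nonneg hfin hK hKE (contDiff_kernelConvolution hε hg hgs)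
    hM (norm_kernelConvolution_le hε hg hgs (fun u => (hg01 u).1) (fun u => (hg01 u).2) ha hga)
    fun v => ?_
  rw [horizontalDiv_kernelConvolution hε hg hgs]
  exact integral_nonneg fun u => mul_nonneg (hg01 u).1 (kernelDensity_nonneg _ _)

lemma mul_volume_le_horizontalPerimeter (hn : 1 ≤ n) {E : Set (HeisenbergSpace n)}
    (hE : NullMeasurableSet E) (hfin : volume E < ∞) {a : ℝ} (ha : 0 < a)
    (hEa : volume E < ENNReal.ofReal a) :
    ENNReal.ofReal (isoConstC n)⁻¹ * volume E ≤
      ENNReal.ofReal (isoConstC' n * a ^ (1 / (2 * n + 2) : ℝ)) * horizontalPerimeter E := by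
  have hc : ENNReal.ofReal (isoConstC n)⁻¹ ≠ 0 := by
    simpa using isoConstC_pos hn
  rw [mul_comm, ← ENNReal.le_div_iff_mul_le (Or.inl hc) (Or.inl ENNReal.ofReal_ne_top)]
  -- Inner regularity needs a measurable set; taking it inside `E` keeps the approximating compacts
  -- inside `E`.
  obtain ⟨E', hE'E, hE', hE'ae⟩ := hE.exists_measurable_subset_ae_eq
  rw [← measure_congr hE'ae]
  refine le_of_forall_lt fun r hr => ?_
  obtain ⟨K, hKE, hK, hrK⟩ := hE'.exists_lt_isCompact_of_ne_top
    ((measure_congr hE'ae).trans_ne hfin.ne) hr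
  refine hrK.trans_le ?_
  rw [ENNReal.le_div_iff_mul_le (Or.inl hc) (Or.inl ENNReal.ofReal_ne_top), mul_comm]
  exact mul_volume_le_of_isCompact hn hfin hK (hKE.trans hE'E) ha hEa

theorem isIsoperimetricBound_isoConst (hn : 1 ≤ n) :
    IsIsoperimetricBound n (ENNReal.ofReal ((isoConstC n)⁻¹ * (isoConstC' n)⁻¹)) := by
  intro E hE hfin
  have hQ : (0 : ℝ) < 2 * n + 2 := by positivity
  have hexp : (homogeneousDim n - 1) / homogeneousDim n = 1 - 1 / (2 * n + 2 : ℝ) := by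
    rw [homogeneousDim, sub_div, div_self hQ.ne']
  have hexp0 : 0 < 1 - 1 / (2 * n + 2 : ℝ) := by
    rw [sub_pos, div_lt_one hQ]; linarith [show (0 : ℝ) ≤ n by positivity]
  rw [hexp]
  rcases eq_or_ne (volume E) 0 with hE0 | hE0
  · rw [hE0, ENNReal.zero_rpow_of_pos hexp0, mul_zero]; exact zero_le
  set V : ℝ := (volume E).toReal with hV
  have hV0 : 0 < V := ENNReal.toReal_pos hE0 hfin.ne
  have hVE : volume E = ENNReal.ofReal V := (ENNReal.ofReal_toReal hfin.ne).symm
  have hC := isoConstC_pos hn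
  have hC' := isoConstC'_pos n
  have hP : ∀ P : ℝ, 0 ≤ P → horizontalPerimeter E = ENNReal.ofReal P →
      (isoConstC n)⁻¹ * (isoConstC' n)⁻¹ * V ^ (1 - 1 / (2 * n + 2 : ℝ)) ≤ P := by
    intro P hP0 hPE
    have h1 : ∀ a, V < a →
        (isoConstC n)⁻¹ * V ≤ isoConstC' n * a ^ (1 / (2 * n + 2) : ℝ) * P := by
      intro a ha
      have ha0 : 0 < a := hV0.trans ha
      have h := mul_volume_le_horizontalPerimeter hn hE hfin ha0
        (by rw [hVE]; exact (ENNReal.ofReal_lt_ofReal_iff ha0).2 ha)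
      rw [hPE, hVE, ← ENNReal.ofReal_mul (by positivity), ← ENNReal.ofReal_mul (by positivity)] at h
      exact (ENNReal.ofReal_le_ofReal_iff (by positivity)).1 h
    -- The strict inequality `a > V` left room for the open neighbourhood; now `a` decreases to `V`.
    have h2 : (isoConstC n)⁻¹ * V ≤ isoConstC' n * V ^ (1 / (2 * n + 2) : ℝ) * P := by
      have hcont : ContinuousAt (fun a : ℝ => isoConstC' n * a ^ (1 / (2 * n + 2) : ℝ) * P) V :=
        ((Real.continuousAt_rpow_const V _ (Or.inl hV0.ne')).const_mul _).mul_const _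
      refine ge_of_tendsto (hcont.tendsto.mono_left (nhdsWithin_le_nhds (s := Set.Ioi V))) ?_
      filter_upwards [self_mem_nhdsWithin] with a ha using h1 a ha
    have hVq : 0 < V ^ (1 / (2 * n + 2) : ℝ) := by positivity
    rw [Real.rpow_sub hV0, Real.rpow_one]
    have e : (isoConstC n)⁻¹ * (isoConstC' n)⁻¹ * (V / V ^ (1 / (2 * n + 2) : ℝ)) =
        (isoConstC n)⁻¹ * V / (isoConstC' n * V ^ (1 / (2 * n + 2) : ℝ)) := by
      field_simp
    rw [e, div_le_iff₀ (by positivity), mul_comm]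
    linarith
  rcases eq_or_ne (horizontalPerimeter E) ∞ with htop | htop
  · rw [htop]; exact le_top
  · have h := hP _ ENNReal.toReal_nonneg (ENNReal.ofReal_toReal htop).symm
    rw [hVE, ENNReal.ofReal_rpow_of_pos hV0, ← ENNReal.ofReal_mul (by positivity),
      ← ENNReal.ofReal_toReal htop]
    exact ENNReal.ofReal_le_ofReal h

end Isoperimetric

/-! ### Explicit constants for `n = 1` and `n = 2`. -/

section SpecialValues

/-- Here `p = 4/3`, and the four Gamma values pair up by the reflection formula at `1/6` and `1/3`,
so none survives. -/
lemma isoConst_one :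
    (isoConstC 1)⁻¹ * (isoConstC' 1)⁻¹ =
      8 * (3 : ℝ) ^ (-(9 / 8) : ℝ) * Real.pi ^ (1 / 4 : ℝ) := by
  have hpi := Real.pi_pos
  have hC : isoConstC 1 = 1 / (4 * Real.pi) := by
    have h2 : (2 : ℝ) ^ ((1 : ℝ) - 3) = 1 / 4 := by
      rw [show (1 : ℝ) - 3 = -2 by norm_num, Real.rpow_neg two_pos.le]; norm_num
    rw [isoConstC, Nat.cast_one, h2, Real.Gamma_one_half_eq, Real.sq_sqrt hpi.le]
    field_simp
  have g1 : Real.Gamma (7 / 6) * Real.Gamma (5 / 6) = Real.pi / 3 := by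
    have h := Real.Gamma_mul_Gamma_one_sub (1 / 6)
    rw [show Real.pi * (1 / 6) = Real.pi / 6 by ring, Real.sin_pi_div_six,
      show (1 - 1 / 6 : ℝ) = 5 / 6 by norm_num] at h
    have h' := Real.Gamma_add_one (s := 1 / 6) (by norm_num)
    rw [show (1 / 6 + 1 : ℝ) = 7 / 6 by norm_num] at h'
    rw [h', mul_assoc, h]; ring
  have g2 : Real.Gamma (5 / 3) * Real.Gamma (4 / 3) = 4 * Real.pi / (9 * √3) := by
    have h := Real.Gamma_mul_Gamma_one_sub (1 / 3)
    rw [show Real.pi * (1 / 3) = Real.pi / 3 by ring, Real.sin_pi_div_three,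
      show (1 - 1 / 3 : ℝ) = 2 / 3 by norm_num] at h
    have h' := Real.Gamma_add_one (s := 1 / 3) (by norm_num)
    have h'' := Real.Gamma_add_one (s := 2 / 3) (by norm_num)
    rw [show (1 / 3 + 1 : ℝ) = 4 / 3 by norm_num] at h'
    rw [show (2 / 3 + 1 : ℝ) = 5 / 3 by norm_num] at h''
    have e : Real.Gamma (5 / 3) * Real.Gamma (4 / 3) =
        2 / 9 * (Real.Gamma (1 / 3) * Real.Gamma (2 / 3)) := by rw [h', h'']; ring
    rw [e, h]; field_simp; norm_num
  have hK : kernelConstant 1 (4 / 3) = Real.pi * (3 * √3 / 4) := by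
    have p1 := Real.Gamma_pos_of_pos (show (0 : ℝ) < 5 / 3 by norm_num)
    have p2 := Real.Gamma_pos_of_pos (show (0 : ℝ) < 4 / 3 by norm_num)
    have h3 : √3 * √3 = 3 := Real.mul_self_sqrt (by norm_num)
    rw [kernelConstant, Nat.cast_one, pow_one, show ((4 / 3 : ℝ) + 1) / 2 = 7 / 6 by norm_num,
      show ((1 : ℝ) / 2 + 4 / 3 / 4) = 5 / 6 by norm_num,
      show ((5 / 6 : ℝ) + 1 / 2) = 4 / 3 by norm_num,
      show ((1 : ℝ) + 4 / 3 / 2) = 5 / 3 by norm_num]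
    have e : Real.pi * Real.Gamma (7 / 6) * (Real.Gamma (5 / 6) / Real.Gamma (4 / 3)) /
        Real.Gamma (5 / 3) = Real.pi * ((Real.Gamma (7 / 6) * Real.Gamma (5 / 6)) /
          (Real.Gamma (5 / 3) * Real.Gamma (4 / 3))) := by field_simp
    rw [e, g1, g2]
    have : √3 ≠ 0 := by positivity
    field_simp
    norm_num
  have hC' : isoConstC' 1 = Real.pi ^ (3 / 4 : ℝ) * (3 : ℝ) ^ (9 / 8 : ℝ) / 2 := by
    rw [isoConstC'_eq, Nat.cast_one, show ((2 * 1 + 2) / (2 * 1 + 1) : ℝ) = 4 / 3 by norm_num, hK,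
      show (1 / (2 * 1 + 2) : ℝ) = 1 / 4 by norm_num,
      show ((2 * 1 + 1) / (2 * 1 + 2) : ℝ) = 3 / 4 by norm_num,
      show (2 * 1 + 2 : ℝ) = 4 by norm_num, Real.mul_rpow hpi.le (by positivity),
      Real.div_rpow (by positivity) (by norm_num)]
    have e3 : (3 * √3 : ℝ) = 3 ^ (3 / 2 : ℝ) := by
      rw [Real.sqrt_eq_rpow, show (3 / 2 : ℝ) = 1 + 1 / 2 by norm_num,
        Real.rpow_add (by norm_num), Real.rpow_one]
    have e4 : ∀ x : ℝ, (4 : ℝ) ^ x = 2 ^ (2 * x) := fun x => by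
      rw [Real.rpow_mul two_pos.le]; norm_num
    have e5 : (2 : ℝ) ^ (3 / 2 : ℝ) = 2 ^ (1 / 2 : ℝ) * 2 := by
      rw [← Real.rpow_add_one two_pos.ne']; norm_num
    rw [e3, ← Real.rpow_mul (by norm_num), e4, e4, show (3 / 2 * (3 / 4) : ℝ) = 9 / 8 by norm_num,
      show (2 * (1 / 4) : ℝ) = 1 / 2 by norm_num, show (2 * (3 / 4) : ℝ) = 3 / 2 by norm_num, e5]
    field_simp
  have e6 : Real.pi = Real.pi ^ (3 / 4 : ℝ) * Real.pi ^ (1 / 4 : ℝ) := by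
    rw [← Real.rpow_add hpi]; norm_num
  rw [hC, hC', Real.rpow_neg (by norm_num)]
  have h7 : Real.pi ^ (3 / 4 : ℝ) ≠ 0 := by positivity
  rw [one_div, inv_inv]
  nth_rewrite 1 [e6]
  field_simp
  norm_num

lemma isoConst_two :
    (isoConstC 2)⁻¹ * (isoConstC' 2)⁻¹ =
      Real.pi ^ (4 / 3 : ℝ) * (6 : ℝ) ^ (-(1 / 6) : ℝ) *
        (Real.Gamma (13 / 5) / Real.Gamma (11 / 10)
          * (Real.Gamma (9 / 5) / Real.Gamma (13 / 10))) ^ (5 / 6 : ℝ) := by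
  have hpi := Real.pi_pos
  have hC : isoConstC 2 = (Real.pi ^ 3)⁻¹ := by
    have h2 : (2 : ℝ) ^ ((2 : ℝ) - 3) = 1 / 2 := by
      rw [show (2 : ℝ) - 3 = -1 by norm_num, Real.rpow_neg_one]; norm_num
    rw [isoConstC, Nat.cast_ofNat, h2, show (2 / 2 : ℝ) = 1 by norm_num, Real.Gamma_one]
    norm_num
  have p1 := Real.Gamma_pos_of_pos (show (0 : ℝ) < 13 / 5 by norm_num)
  have p2 := Real.Gamma_pos_of_pos (show (0 : ℝ) < 11 / 10 by norm_num)
  have p3 := Real.Gamma_pos_of_pos (show (0 : ℝ) < 9 / 5 by norm_num)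
  have p4 := Real.Gamma_pos_of_pos (show (0 : ℝ) < 13 / 10 by norm_num)
  set T : ℝ := Real.Gamma (13 / 5) / Real.Gamma (11 / 10)
          * (Real.Gamma (9 / 5) / Real.Gamma (13 / 10)) with hT
  have hT0 : 0 < T := by positivity
  have hK : kernelConstant 2 (6 / 5) = Real.pi ^ 2 * T⁻¹ := by
    rw [kernelConstant, Nat.cast_ofNat, show ((6 / 5 : ℝ) + 1) / 2 = 11 / 10 by norm_num,
      show ((2 : ℝ) / 2 + 6 / 5 / 4) = 13 / 10 by norm_num,
      show ((13 / 10 : ℝ) + 1 / 2) = 9 / 5 by norm_num,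
      show ((2 : ℝ) + 6 / 5 / 2) = 13 / 5 by norm_num, hT]
    field_simp
  have hC' : isoConstC' 2 = (6 : ℝ) ^ (1 / 6 : ℝ) * (Real.pi ^ (5 / 3 : ℝ) * (T ^ (5 / 6 : ℝ))⁻¹) := by
    rw [isoConstC'_eq, Nat.cast_ofNat, show ((2 * 2 + 2) / (2 * 2 + 1) : ℝ) = 6 / 5 by norm_num, hK,
      show (1 / (2 * 2 + 2) : ℝ) = 1 / 6 by norm_num,
      show ((2 * 2 + 1) / (2 * 2 + 2) : ℝ) = 5 / 6 by norm_num,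
      show (2 * 2 + 2 : ℝ) = 6 by norm_num, Real.mul_rpow (by positivity) (by positivity),
      Real.inv_rpow hT0.le, ← Real.rpow_natCast, ← Real.rpow_mul hpi.le]
    norm_num
  have e : Real.pi ^ 3 = Real.pi ^ (5 / 3 : ℝ) * Real.pi ^ (4 / 3 : ℝ) := by
    rw [← Real.rpow_add hpi, ← Real.rpow_natCast]; norm_num
  rw [hC, hC', inv_inv, e, Real.rpow_neg (by norm_num)]
  field_simp

lemma abs_isoConst_one_sub_lt :
    |8 * (3 : ℝ) ^ (-(9 / 8) : ℝ) * Real.pi ^ (1 / 4 : ℝ) - 3.09468| < 0.00001 := by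
  set x : ℝ := 8 * (3 : ℝ) ^ (-(9 / 8) : ℝ) * Real.pi ^ (1 / 4 : ℝ) with hx
  have hx0 : 0 < x := by positivity
  -- The eighth power clears both fractional exponents, so six-digit bounds on `π` decide the
  -- comparison.
  have h8 : x ^ 8 = 8 ^ 8 / 3 ^ 9 * Real.pi ^ 2 := by
    rw [hx, mul_pow, mul_pow, ← Real.rpow_natCast (3 ^ _), ← Real.rpow_mul (by norm_num),
      ← Real.rpow_natCast (Real.pi ^ _), ← Real.rpow_mul Real.pi_pos.le, ← Real.rpow_natCast Real.pi,
      show (-(9 / 8) * ((8 : ℕ) : ℝ) : ℝ) = -((9 : ℕ) : ℝ) by norm_num,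
      show (1 / 4 * ((8 : ℕ) : ℝ) : ℝ) = ((2 : ℕ) : ℝ) by norm_num, Real.rpow_neg (by norm_num),
      Real.rpow_natCast 3]
    ring
  have l := Real.pi_gt_d6
  have u := Real.pi_lt_d6
  have l2 : (3.141592 : ℝ) ^ 2 ≤ Real.pi ^ 2 := by gcongr
  have u2 : Real.pi ^ 2 ≤ (3.141593 : ℝ) ^ 2 := by gcongr
  rw [abs_lt]
  constructor
  · have : (3.09467 : ℝ) < x := by
      rw [← pow_lt_pow_iff_left₀ (by norm_num) hx0.le (by norm_num : 8 ≠ 0), h8]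
      norm_num at l2 ⊢; linarith
    linarith
  · have : x < (3.09469 : ℝ) := by
      rw [← pow_lt_pow_iff_left₀ hx0.le (by norm_num) (by norm_num : 8 ≠ 0), h8]
      norm_num at u2 ⊢; linarith
    linarith

end SpecialValues

theorem mainTheorem11 :
    (∀ n : ℕ, 1 ≤ n →
      ENNReal.ofReal ((isoConstC n)⁻¹ * (isoConstC' n)⁻¹) ≤ isoperimetricConstant n) ∧
    ENNReal.ofReal (8 * (3 : ℝ) ^ (-(9 / 8) : ℝ) * Real.pi ^ (1 / 4 : ℝ))
      ≤ isoperimetricConstant 1 ∧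
    |8 * (3 : ℝ) ^ (-(9 / 8) : ℝ) * Real.pi ^ (1 / 4 : ℝ) - 3.09468| < 0.00001 ∧
    ENNReal.ofReal (Real.pi ^ (4 / 3 : ℝ) * (6 : ℝ) ^ (-(1 / 6) : ℝ) *
        (Real.Gamma (13 / 5) / Real.Gamma (11 / 10)
          * (Real.Gamma (9 / 5) / Real.Gamma (13 / 10))) ^ (5 / 6 : ℝ))
      ≤ isoperimetricConstant 2 := by
  have main : ∀ n : ℕ, 1 ≤ n →
      ENNReal.ofReal ((isoConstC n)⁻¹ * (isoConstC' n)⁻¹) ≤ isoperimetricConstant n :=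
    fun n hn => (isGreatest_isoperimetricConstant n).2 (isIsoperimetricBound_isoConst hn)
  refine ⟨main, ?_, abs_isoConst_one_sub_lt, ?_⟩
  · rw [← isoConst_one]; exact main 1 le_rfl
  · rw [← isoConst_two]; exact main 2 one_le_two
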